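/- **Setting.** A one-server QPIR protocol of unitary type for $f$ messages of dimension $d$: the server holds message systems $\mathcal H_1,\dots,\mathcal H_f\cong\mathbb C^d$ and a system $\mathcal R_s$, the user holds $\mathcal R_u$ and a choice $k\in\{1,\dots,f\}$, and $\mathcal R_u\otimes\mathcal R_s$ starts in a pure state (prior entanglement allowed). In each round the user applies a unitary operation (possibly with fresh ancillas in a pure state), depending on $k$, to her systems and sends a query register; the server applies a unitary operation to the query and his systems and sends an answer register. At the end the user makes a measurement. The inputs are classical: the messages are in states $|a_1\rangle,\dots,|a_f\rangle$ with $a_i\in\{0,\dots,d-1\}$. An attack of the server replaces, in every round $j$, his operation by an arbitrary quantum operation on the received query and his memory (of arbitrary finite dimension), the answer register being of the prescribed type. Let $\rho_j(a,k)$ and $\tilde\rho_j(a,k)$ be the states of the whole system when the user receives the $j$-th answer, without and with the attack. The attack is *specious* (for classical inputs) if for every round $j$ there is a quantum operation $\mathcal F_j$ on the server's system with $(\mathcal F_j\otimes\iota)\tilde\rho_j(a,k)=\rho_j(a,k)$ for all $a$ and $k$. The protocol is *secret in the all-round criterion under the specious-server model for classical inputs* if under every specious attack, for every round $j$, every $a$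 and all $k,k'$, the state $\tilde\rho_{S,j}$ of the server at the time when he receives the $j$-th query satisfies $\tilde\rho_{S,j}(a,k)=\tilde\rho_{S,j}(a,k')$. **Protocol A (no prior entanglement).** Take any one-round classical $s$-server PIR protocol for messages $a_1,\dots,a_f\in\{0,1\}$: the user draws $G$ uniformly from a finite set, sends $q_t(G,k)$ to the $t$-th server ($t=1,\dots,s$), receives $\mathrm{ans}_t(q_t(G,k))$, which depends on $a$, and recovers $a_k$ with certainty; for each $t$ the distribution of $q_t(G,k)$ does not depend on $k$. In the one-server quantum protocol the user prepares $$\sum_{q=(q_1,\dots,q_s)}\sqrt{\Pr[(q_1(G,k),\dots,q_s(G,k))=q]}\;|q\rangle_{Q}\,|q_1\rangle_{Q_1}\cdots|q_s\rangle_{Q_s}\,|0\rangle_{\mathrm{Ans}_1}\cdots|0\rangle_{\mathrm{Ans}_s}.$$ For $t=1,\dots,s$ she sends $Q_t,\mathrm{Ans}_t$, the server applies $|q\rangle|b\rangle\mapsto|q\rangle|b+\mathrm{ans}_t(q)\rangle$ and sends them back. Finally she computes and measures $a_k$. **Protocol B (prior entanglement).** Let $f=2^h$, $h\ge1$, with messages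 $a=(a_1,\dots,a_f)\in\{0,1\}^f$. For $p=1,\dots,h$ the server's register $R_p$ and the user's register $R'_p$ share $2^{-2^{h-p}/2}\sum_{z\in\{0,1\}^{2^{h-p}}}|z\rangle|z\rangle$; $R_0$ holds $a$; the server has two qubits $Q_0,Q_1$ in $|0\rangle|0\rangle$. Write $y[0],y[1]$ for the first and the second half of a string $y$, and let $V_p:|y\rangle_{R_{p-1}}|z\rangle_{R_p}|b_0\rangle_{Q_0}|b_1\rangle_{Q_1}\mapsto|y\rangle|z\rangle|b_0\oplus y[0]\cdot z\rangle|b_1\oplus y[1]\cdot z\rangle$. For $p=1,\dots,h$: the server applies $V_p$ and sends $Q_0,Q_1$; the user applies the Pauli gate $Z$ to $Q_i$, where $i$ is the $p$-th bit (most significant first) of the $h$-bit binary expansion of $k-1$, and sends $Q_0,Q_1$ back; the server applies $V_p$ again and a Hadamard gate to each qubit of $R_p$; the user applies a Hadamard gate to each qubit of $R'_p$. Finally the server sends $R_h$, and the user measures and computes $a_k$ as a parity of bits of $R'_1,\dots,R'_h,R_h$. **Corollary.** Protocol A, for every underlying classical PIR protocol, and Protocol B, for every $h\ge1$, are secret in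 the all-round criterion under the specious-server model for classical inputs. -/

import Mathlib

open scoped Matrix Kronecker

noncomputable section

namespace QPIR

/-! ## Finite-dimensional quantum systems

A system is given by a finite type of labels of its computational basis; a state is a density
matrix over that type, and tensor products of systems are products of the label types. -/

open Classical in
/-- An isometry `ℂ^m → ℂ^n`, that is, a unitary operation which may first append ancillas in a
fixed pure state. When `m` and `n` have the same cardinality it is a unitary operation. -/
structure Isom (m n : Type) [Fintype m] [Fintype n] where
  mat : Matrix n m ℂ
  isometry : matᴴ * mat = 1

open Classical in
/-- A quantum operation (completely positive trace-preserving map) in Kraus form. -/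
structure Channel (m n : Type) [Fintype m] [Fintype n] where
  num : ℕ
  kraus : Fin num → Matrix n m ℂ
  tracePreserving : ∑ e, (kraus e)ᴴ * kraus e = 1

section Basic

variable {m n l m' n' : Type}
  [Fintype m] [Fintype n] [Fintype l]
  [Fintype m'] [Fintype n']

open Classical in
/-- First `A`, then `B`. -/
def Isom.andThen (A : Isom m n) (B : Isom n l) : Isom m l where
  mat := B.mat * A.mat
  isometry := by
    rw [Matrix.conjTranspose_mul, Matrix.mul_assoc, ← Matrix.mul_assoc B.matᴴ, B.isometry,
      Matrix.one_mul, A.isometry]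

open Classical in
/-- The identity. -/
def Isom.id (m : Type) [Fintype m] : Isom m m where
  mat := 1
  isometry := by simp

open Classical in
/-- `A ⊗ B`. -/
def Isom.tensor (A : Isom m n) (B : Isom m' n') : Isom (m × m') (n × n') where
  mat := A.mat ⊗ₖ B.mat
  isometry := by
    rw [Matrix.conjTranspose_kronecker, ← Matrix.mul_kronecker_mul, A.isometry, B.isometry,
      Matrix.one_kronecker_one]
    congr!

open Classical in
/-- The operation `|x⟩ ↦ |g x⟩` of an injective map `g` of basis labels. -/
def Isom.ofInjective (g : m → n) (hg : Function.Injective g) : Isom m n where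
  mat := Matrix.of fun y x => if y = g x then 1 else 0
  isometry := by
    ext x x'
    simp [Matrix.mul_apply, Matrix.one_apply, hg.eq_iff, eq_comm]

/-- A relabelling of the basis, for instance a regrouping of registers. -/
def Isom.ofEquiv (e : m ≃ n) : Isom m n := Isom.ofInjective e e.injective

/-- The state preparation of a unit vector `v`. -/
def Isom.prepare (v : n → ℂ) (hv : ∑ x, ‖v x‖ ^ 2 = 1) : Isom Unit n where
  mat := Matrix.of fun x _ => v x
  isometry := by
    ext _ _
    simp only [Matrix.mul_apply, Matrix.conjTranspose_apply, Matrix.of_apply, Matrix.one_apply_eq,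
      RCLike.star_def, Complex.conj_mul']
    exact_mod_cast hv

/-- An isometry seen as a quantum operation. -/
def Isom.toChannel (A : Isom m n) : Channel m n where
  num := 1
  kraus := fun _ => A.mat
  tracePreserving := by simp [A.isometry]

end Basic

section States

variable {W U Q A S S' : Type}
  [Fintype W] [Fintype U] [Fintype Q]
  [Fintype A] [Fintype S] [Fintype S']

open Classical in
/-- `(ι ⊗ Φ)(ρ)`: the operation `Φ` on the second system, the identity on the first. -/
def Channel.onServer (Φ : Channel S S') (ρ : Matrix (W × S) (W × S) ℂ) :
    Matrix (W × S') (W × S') ℂ :=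
  ∑ e, ((1 : Matrix W W ℂ) ⊗ₖ Φ.kraus e) * ρ * ((1 : Matrix W W ℂ) ⊗ₖ Φ.kraus e)ᴴ

/-- The reduced state on the second system, which is the server's. -/
def serverState (ρ : Matrix (W × S) (W × S) ℂ) : Matrix S S ℂ :=
  Matrix.of fun s s' => ∑ w, ρ (w, s) (w, s')

open Classical in
/-- The user applies `V` to her system `W`, keeps `U` and sends the query register `Q`;
the result is the state at the time when the server has received the query. -/
def sendQuery (V : Isom W (U × Q)) (ρ : Matrix (W × S) (W × S) ℂ) :
    Matrix (U × (Q × S)) (U × (Q × S)) ℂ :=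
  Matrix.reindex (Equiv.prodAssoc U Q S) (Equiv.prodAssoc U Q S)
    ((V.mat ⊗ₖ (1 : Matrix S S ℂ)) * ρ * (V.mat ⊗ₖ (1 : Matrix S S ℂ))ᴴ)

/-- The server applies `Φ` to the query and his memory, keeps `S'` and sends the answer register
`A`; the result is the state at the time when the user has received the answer. -/
def sendAnswer (Φ : Channel (Q × S) (A × S')) (ρ : Matrix (U × (Q × S)) (U × (Q × S)) ℂ) :
    Matrix ((U × A) × S') ((U × A) × S') ℂ :=
  Matrix.reindex (Equiv.prodAssoc U A S').symm (Equiv.prodAssoc U A S').symm (Φ.onServer ρ)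

end States

/-! ## Protocols of unitary type -/

/-- The interaction of an honest user and an honest server, from a point where the user holds the
system `W` and the server holds the system `S`. Here `f` is the number of messages and `d` their
dimension. In each round the user, depending on her choice `k : Fin f`, applies an operation to
`W`, keeps `U` and sends the query `Q`; the server applies an operation to `Q` and `S`, sends the
answer `A` and keeps `S'`. At the end the user applies an operation that leaves the retrieved
message in a `d`-dimensional output register, which she measures. -/
inductive Interaction (f d : ℕ) : (W : Type) → [Fintype W] →
    (S : Type) → [Fintype S] → Type 1
  | done {W S Z : Type} [Fintype W] [Fintype S]
      [Fintype Z] (output : Fin f → Isom W (Z × Fin d)) : Interaction f d W S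
  | round {W S U Q A S' : Type} [Fintype W] [Fintype S]
      [Fintype U] [Fintype Q] [Fintype A]
      [Fintype S'] (user : Fin f → Isom W (U × Q))
      (server : Isom (Q × S) (A × S')) (next : Interaction f d (U × A) S') : Interaction f d W S

/-- Basis labels of the `f` message systems, each of dimension `d`. -/
abbrev Messages (f d : ℕ) : Type := Fin f → Fin d

/-- A QPIR protocol of unitary type: the server holds the message systems and `Rs`, the user holds
`Ru`; the systems `Ru` and `Rs` are initially in a pure state (prior entanglement is allowed). -/
structure Protocol (f d : ℕ) where
  Ru : Type
  Rs : Type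
  [fintypeRu : Fintype Ru]
  [fintypeRs : Fintype Rs]
  init : Ru × Rs → ℂ
  init_norm : ∑ x, ‖init x‖ ^ 2 = 1
  body : Interaction f d Ru (Messages f d × Rs)

attribute [instance] Protocol.fintypeRu Protocol.fintypeRs

/-- The product state `ρ₁ ⊗ ⋯ ⊗ ρ_f` of the messages. -/
def productState {f d : ℕ} (ρ : Fin f → Matrix (Fin d) (Fin d) ℂ) :
    Matrix (Messages f d) (Messages f d) ℂ :=
  Matrix.of fun x y => ∏ i, ρ i (x i) (y i)

/-- The state of the whole system before the first round when the messages are in the states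
`ρ₁, …, ρ_f`. -/
def Protocol.initialState {f d : ℕ} (P : Protocol f d) (ρ : Fin f → Matrix (Fin d) (Fin d) ℂ) :
    Matrix (P.Ru × (Messages f d × P.Rs)) (P.Ru × (Messages f d × P.Rs)) ℂ :=
  Matrix.of fun x y =>
    P.init (x.1, x.2.2) * star (P.init (y.1, y.2.2)) * productState ρ x.2.1 y.2.1

/-- Classical inputs: the set of the orthogonal pure states `|j⟩⟨j|`, `j = 0, …, d - 1`. -/
def classicalInputs (d : ℕ) : Set (Matrix (Fin d) (Fin d) ℂ) :=
  Set.range fun j => Matrix.single j j 1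

/-! ## Attacks of the server and secrecy -/

/-- An attack of a server whose system is `T`, against the remaining rounds of a protocol: in each
round an arbitrary quantum operation on the received query and `T`, with an answer of the type that
the protocol prescribes and a new memory `T'` of arbitrary dimension. -/
inductive Interaction.Attack {f d : ℕ} : {W S : Type} → [Fintype W] → [Fintype S] →
    Interaction f d W S → (T : Type) → [Fintype T] → Type 1
  | done {W S Z T : Type} [Fintype W] [Fintype S] [Fintype Z] [Fintype T]
      {output : Fin f → Isom W (Z × Fin d)} : Attack (Interaction.done (S := S) output) T
  | round {W S U Q A S' T T' : Type} [Fintype W] [Fintype S] [Fintype U] [Fintype Q] [Fintype A]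
      [Fintype S'] [Fintype T] [Fintype T'] {user : Fin f → Isom W (U × Q)}
      {server : Isom (Q × S) (A × S')} {next : Interaction f d (U × A) S'}
      (Φ : Channel (Q × T) (A × T')) (att : Attack next T') :
      Attack (Interaction.round user server next) T

/-- The attack is specious. `ι` indexes the admissible inputs of the server, `ρ i k` is the state of
the whole system in the honest execution with input `i` and choice `k`, and `ρ' i k` the one when
the server attacks. In every round, at the time when the user has received the answer, some
operation of the server, which depends neither on the inputs nor on the choice, turns the second
state into the first. -/
def Interaction.Attack.IsSpecious {f d : ℕ} {ι : Type} : {W S T : Type} → [Fintype W] →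
    [Fintype S] → [Fintype T] → {π : Interaction f d W S} → π.Attack T →
    (ρ : ι → Fin f → Matrix (W × S) (W × S) ℂ) →
    (ρ' : ι → Fin f → Matrix (W × T) (W × T) ℂ) → Prop
  | _, _, _, _, _, _, _, @Attack.done _ _ _ _ _ _ _ _ _ _ _, _, _ => True
  | _, _, _, _, _, _, _,
      @Attack.round _ _ _ _ _ _ _ S' _ T' _ _ _ _ _ _ _ _ user server _ Φ att, ρ, ρ' =>
      let τ := fun i k => sendAnswer server.toChannel (sendQuery (user k) (ρ i k))
      let τ' := fun i k => sendAnswer Φ (sendQuery (user k) (ρ' i k))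
      (∃ F : Channel T' S', ∀ i k, F.onServer (τ' i k) = τ i k) ∧ att.IsSpecious τ τ'

/-- All-round criterion under a given attack: in every round, at the time when the server has
received the query, the state of the attacking server does not depend on the choice `k`. -/
def Interaction.Attack.HidesChoice {f d : ℕ} {ι : Type} : {W S T : Type} → [Fintype W] →
    [Fintype S] → [Fintype T] → {π : Interaction f d W S} → π.Attack T →
    (ρ' : ι → Fin f → Matrix (W × T) (W × T) ℂ) → Prop
  | _, _, _, _, _, _, _, @Attack.done _ _ _ _ _ _ _ _ _ _ _, _ => True
  | _, _, _, _, _, _, _,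
      @Attack.round _ _ _ _ _ _ _ _ _ _ _ _ _ _ _ _ _ _ user _ _ Φ att, ρ' =>
      let σ' := fun i k => sendQuery (user k) (ρ' i k)
      (∀ i k k', serverState (σ' i k) = serverState (σ' i k')) ∧
        att.HidesChoice fun i k => sendAnswer Φ (σ' i k)

/-- Secrecy in the all-round criterion under the specious-server model, with set `inputs` of
possible inputs (both in the definition of a specious attack and in the secrecy condition). -/
def Protocol.SpeciousSecret {f d : ℕ} (P : Protocol f d)
    (inputs : Set (Matrix (Fin d) (Fin d) ℂ)) : Prop :=
  let ρ := fun (i : {ρ : Fin f → Matrix (Fin d) (Fin d) ℂ // ∀ l, ρ l ∈ inputs}) (_ : Fin f) =>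
    P.initialState i.1
  ∀ att : P.body.Attack (Messages f d × P.Rs),
    att.IsSpecious ρ ρ → att.HidesChoice ρ

/-! ## Simulation of a classical multi-server protocol by one quantum server -/

/-- A one-round classical `s`-server PIR protocol for `f` one-bit messages: the user draws `g`
uniformly, sends `query t g k` to the `t`-th server and receives `answer t a (query t g k)`, where
`a` is the list of messages. She recovers the `k`-th message with certainty, and the distribution
of the query to each single server does not depend on `k`. -/
structure ClassicalPIR (f s : ℕ) where
  seeds : ℕ
  seeds_pos : 0 < seeds
  Query : Fin s → Type
  Answer : Fin s → Type
  [fintypeQuery : ∀ t, Fintype (Query t)]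
  [decQuery : ∀ t, DecidableEq (Query t)]
  [fintypeAnswer : ∀ t, Fintype (Answer t)]
  [decAnswer : ∀ t, DecidableEq (Answer t)]
  [groupAnswer : ∀ t, AddCommGroup (Answer t)]
  query : (t : Fin s) → Fin seeds → Fin f → Query t
  answer : (t : Fin s) → Messages f 2 → Query t → Answer t
  recover : Fin f → ((t : Fin s) → Query t) → ((t : Fin s) → Answer t) → Fin 2
  correct : ∀ (a : Messages f 2) (g : Fin seeds) (k : Fin f),
    recover k (fun t => query t g k) (fun t => answer t a (query t g k)) = a k
  private_query : ∀ (t : Fin s) (k k' : Fin f) (q : Query t),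
    (Finset.univ.filter fun g => query t g k = q).card =
      (Finset.univ.filter fun g => query t g k' = q).card

attribute [instance] ClassicalPIR.fintypeQuery ClassicalPIR.decQuery ClassicalPIR.fintypeAnswer
  ClassicalPIR.decAnswer ClassicalPIR.groupAnswer

namespace ClassicalPIR

variable {f s : ℕ} (C : ClassicalPIR f s)

/-- Content of the register `𝖰`: a tuple of queries. -/
abbrev Queries : Type := (t : Fin s) → C.Query t

/-- Content of the pair of registers `𝖰_t, 𝖠𝗇𝗌_t`. -/
abbrev Pair (t : Fin s) : Type := C.Query t × C.Answer t

/-- Content of all registers `𝖰, 𝖰_1, …, 𝖰_s, 𝖠𝗇𝗌_1, …, 𝖠𝗇𝗌_s`. -/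
abbrev Full : Type := C.Queries × ((t : Fin s) → C.Pair t)

/-- Content of all registers except `𝖰_t, 𝖠𝗇𝗌_t`. -/
abbrev Rest (t : Fin s) : Type := C.Queries × ((j : {j : Fin s // j ≠ t}) → C.Pair j)

/-- Separating the registers `𝖰_t, 𝖠𝗇𝗌_t` from the others. -/
def split (t : Fin s) : C.Full ≃ C.Rest t × C.Pair t :=
  ((Equiv.refl C.Queries).prodCongr
    ((Equiv.piSplitAt t C.Pair).trans (Equiv.prodComm _ _))).trans
    (Equiv.prodAssoc _ _ _).symm

/-- The number of `g` for which the tuple of queries is `q`. -/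
def multiplicity (k : Fin f) (q : C.Queries) : ℕ :=
  (Finset.univ.filter fun g => (fun t => C.query t g k) = q).card

/-- The state `|Φ_1⟩` for the choice `k`: the sum over all tuples `q` of queries of
`√(Pr[q]) |q⟩_𝖰 |q_1⟩ ⋯ |q_s⟩ |0⟩ ⋯ |0⟩`. If no tuple arises from two different seeds `g`, this is
the uniform superposition `1/√seeds * ∑_g |q_1(g,k), …, q_s(g,k)⟩ ⋯`. -/
def queryState (k : Fin f) (x : C.Full) : ℂ :=
  if x.2 = fun t => (x.1 t, 0) then
    ((Real.sqrt ((C.multiplicity k x.1 : ℝ) / C.seeds) : ℝ) : ℂ) else 0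

theorem queryState_norm (k : Fin f) : ∑ x, ‖C.queryState k x‖ ^ 2 = 1 := by
  have h0 : (C.seeds : ℝ) ≠ 0 := by exact_mod_cast C.seeds_pos.ne'
  have h1 : ∀ x : C.Full, ‖C.queryState k x‖ ^ 2 =
      if x.2 = fun t => (x.1 t, 0) then (C.multiplicity k x.1 : ℝ) / C.seeds else 0 := by
    intro x
    unfold queryState
    split_ifs
    · rw [Complex.norm_real, Real.norm_eq_abs, sq_abs, Real.sq_sqrt (by positivity)]
    · simp
  simp_rw [h1]
  rw [Fintype.sum_prod_type]
  simp only [Finset.sum_ite_eq', Finset.mem_univ, if_true]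
  rw [← Finset.sum_div, div_eq_one_iff_eq h0]
  have h2 := Finset.card_eq_sum_card_fiberwise (s := (Finset.univ : Finset (Fin C.seeds)))
    (t := (Finset.univ : Finset C.Queries)) (f := fun g t => C.query t g k) (by simp)
  rw [Finset.card_univ, Fintype.card_fin] at h2
  unfold multiplicity
  exact_mod_cast h2.symm

/-- The server's operation in the `t`-th round: `|q⟩|b⟩ ↦ |q⟩|b + answer t a q⟩` on the registers
`𝖰_t, 𝖠𝗇𝗌_t`, for messages `a`. -/
def serverOp (t : Fin s) :
    Isom (C.Pair t × (Messages f 2 × Unit)) (C.Pair t × (Messages f 2 × Unit)) :=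
  Isom.ofInjective
    (fun x => ((x.1.1, x.1.2 + C.answer t x.2.1 x.1.1), x.2))
    (by
      rintro ⟨⟨q, b⟩, a, u⟩ ⟨⟨q', b'⟩, a', u'⟩ h
      simp only [Prod.mk.injEq] at h
      obtain ⟨⟨rfl, h⟩, rfl, -⟩ := h
      simpa using h)

/-- The final step of the user: she computes the message from the queries and the answers in an
output register. -/
def outputOp (k : Fin f) : Isom C.Full (C.Full × Fin 2) :=
  Isom.ofInjective (fun x => (x, C.recover k x.1 (fun t => (x.2 t).2)))
    (fun _ _ h => congrArg Prod.fst h)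

/-- The rounds for the servers `t` in a list: the user sends the registers `𝖰_t, 𝖠𝗇𝗌_t`, the server
applies his operation to them and sends them back. The operation `pre` is what the user does
first. -/
def rounds : {W : Type} → [Fintype W] → (pre : Fin f → Isom W C.Full) →
    List (Fin s) → Interaction f 2 W (Messages f 2 × Unit)
  | _, _, pre, [] => .done fun k => (pre k).andThen (C.outputOp k)
  | _, _, pre, t :: ts =>
      .round (fun k => (pre k).andThen (Isom.ofEquiv (C.split t))) (C.serverOp t)
        (rounds (fun _ => Isom.ofEquiv (C.split t).symm) ts)

/-- The one-server protocol without prior entanglement that simulates `C`: the user prepares the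
state `|Φ_1⟩`, and then the rounds `t = 1, …, s` take place. -/
def simulation : Protocol f 2 where
  Ru := Unit
  Rs := Unit
  init := fun _ => 1
  init_norm := by simp
  body := C.rounds (fun k => Isom.prepare (C.queryState k) (C.queryState_norm k)) (List.finRange s)

end ClassicalPIR

/-! ## The protocol with prior entanglement

The number of messages is `2 ^ h`. The registers are indexed by `ℓ : Fin h`, where `ℓ = h - p` for
the `p`-th round: the registers with index `ℓ` hold strings of `2 ^ ℓ` bits, the rounds use
`ℓ = h - 1, …, 1, 0` in this order, and the `p`-th bit of the choice, the first being the most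
significant, is the coefficient of `2 ^ ℓ`. -/

namespace Entangled

/-- Bit strings of length `2 ^ l`. -/
abbrev Str (l : ℕ) : Type := Fin (2 ^ l) → Fin 2

/-- The content of the registers `𝖱_1, …, 𝖱_h`, or of `𝖱'_1, …, 𝖱'_h`. -/
abbrev Regs (h : ℕ) : Type := (ℓ : Fin h) → Str ℓ

/-- The content of the qubits `𝖰_0, 𝖰_1`. -/
abbrev Qubits : Type := Fin 2 × Fin 2

/-- The first half `y[0]` and the second half `y[1]` of a string `y`. -/
def half {l : ℕ} (i : Fin 2) (y : Str (l + 1)) : Str l :=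
  fun t => y ⟨i * 2 ^ l + t, by
    have h1 := i.isLt
    have h2 := t.isLt
    rw [pow_succ]
    nlinarith [Nat.mul_le_mul_right (2 ^ l) (Nat.le_of_lt_succ h1)]⟩

/-- The inner product modulo 2. -/
def dot {l : ℕ} (y z : Str l) : Fin 2 := ∑ t, y t * z t

/-- The content of the register that precedes the one with index `ℓ` (the previous register of the
server, or the messages themselves in the first round). -/
def previous {h : ℕ} (a : Str h) (r : Regs h) (ℓ : Fin h) : Str (ℓ + 1) :=
  Fin.snoc (α := fun i : Fin (h + 1) => Str i) r a ℓ.succ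

/-- The server's unitary
`V : |y⟩|z⟩|b₀⟩|b₁⟩ ↦ |y⟩|z⟩|b₀ ⊕ y[0]·z⟩|b₁ ⊕ y[1]·z⟩` on the previous register, the register
with index `ℓ` and the two qubits. -/
def V {h : ℕ} (ℓ : Fin h) : Isom (Qubits × (Str h × Regs h)) (Qubits × (Str h × Regs h)) :=
  Isom.ofInjective
    (fun x => ((x.1.1 + dot (half 0 (previous x.2.1 x.2.2 ℓ)) (x.2.2 ℓ),
      x.1.2 + dot (half 1 (previous x.2.1 x.2.2 ℓ)) (x.2.2 ℓ)), x.2))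
    (by
      rintro ⟨⟨b, c⟩, w⟩ ⟨⟨b', c'⟩, w'⟩ h
      simp only [Prod.mk.injEq] at h
      obtain ⟨⟨h1, h2⟩, rfl⟩ := h
      simp only [add_left_inj] at h1 h2
      rw [h1, h2])

/-- The Hadamard matrix of one qubit. -/
def hadamardEntry (x y : Fin 2) : ℂ :=
  (if x = 1 ∧ y = 1 then -1 else 1) / ((Real.sqrt 2 : ℝ) : ℂ)

theorem hadamardEntry_sum (x x' : Fin 2) :
    ∑ b, star (hadamardEntry b x) * hadamardEntry b x' = if x = x' then 1 else 0 := by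
  have h2 : ((Real.sqrt 2 : ℝ) : ℂ) * ((Real.sqrt 2 : ℝ) : ℂ) = 2 := by
    rw [← Complex.ofReal_mul, Real.mul_self_sqrt (by norm_num)]; norm_num
  fin_cases x <;> fin_cases x' <;>
    (simp [hadamardEntry, Fin.sum_univ_two, ← mul_inv, h2, div_eq_mul_inv]; try norm_num)

/-- The Hadamard transform on each qubit of a string. -/
def hadamard (l : ℕ) : Isom (Str l) (Str l) where
  mat := Matrix.of fun x y => ∏ t, hadamardEntry (x t) (y t)
  isometry := by
    ext x x'
    simp only [Matrix.mul_apply, Matrix.conjTranspose_apply, Matrix.of_apply, Matrix.one_apply,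
      star_prod, ← Finset.prod_mul_distrib]
    rw [← Fintype.prod_sum (fun t b => star (hadamardEntry b (x t)) * hadamardEntry b (x' t))]
    simp only [hadamardEntry_sum, Finset.prod_ite_zero, Finset.prod_const_one, Finset.mem_univ,
      true_imp_iff, funext_iff]

/-- The Hadamard transform on each qubit of the register with index `ℓ`. -/
def hadamardAt {h : ℕ} (ℓ : Fin h) : Isom (Regs h) (Regs h) :=
  (Isom.ofEquiv (Equiv.piSplitAt ℓ fun j : Fin h => Str j)).andThen
    (((hadamard ℓ).tensor (Isom.id _)).andThen
      (Isom.ofEquiv (Equiv.piSplitAt ℓ fun j : Fin h => Str j).symm))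

/-- The server's operation after receiving the two qubits: `V` and the Hadamard transforms. -/
def serverStep {h : ℕ} (ℓ : Fin h) :
    Isom (Qubits × (Str h × Regs h)) (Qubits × (Str h × Regs h)) :=
  (V ℓ).andThen ((Isom.id Qubits).tensor ((Isom.id (Str h)).tensor (hadamardAt ℓ)))

/-- The bit of the choice that is used with the registers of index `ℓ`. -/
def choiceBit {h : ℕ} (k : Fin (2 ^ h)) (ℓ : Fin h) : Bool := Nat.testBit k ℓ

/-- The Pauli gate `Z` on `𝖰_0` if `i` is `false`, and on `𝖰_1` if `i` is `true`. -/
def pauliZ (i : Bool) : Isom Qubits Qubits where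
  mat := Matrix.diagonal fun b => if (if i then b.2 else b.1) = 1 then -1 else 1
  isometry := by
    rw [Matrix.diagonal_conjTranspose, Matrix.diagonal_mul_diagonal]
    ext b b'
    simp only [Pi.star_apply, Matrix.diagonal_apply, Matrix.one_apply]
    split_ifs <;> simp

/-- At the very end the server sends the one-qubit register with index `0`. -/
def sendLast {n : ℕ} :
    Isom (Qubits × (Str (n + 1) × Regs (n + 1)))
      (Str 0 × (Str (n + 1) × (Qubits × ((j : {j : Fin (n + 1) // j ≠ 0}) → Str j)))) :=
  Isom.ofEquiv
    { toFun := fun x =>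
        let y := Equiv.piSplitAt (0 : Fin (n + 1)) (fun j => Str j) x.2.2
        (y.1, x.2.1, x.1, y.2)
      invFun := fun x => (x.2.2.1, x.2.1,
        (Equiv.piSplitAt (0 : Fin (n + 1)) (fun j => Str j)).symm (x.1, x.2.2.2))
      left_inv := fun x => by simp only [Prod.mk.eta, Equiv.symm_apply_apply]
      right_inv := fun x => by simp only [Prod.mk.eta, Equiv.apply_symm_apply] }

/-- The user's output, the parity of the bit received last and of one bit of each of her registers:
from the register with index `ℓ` she takes the bit at position `k mod 2 ^ ℓ`. -/
def outputBit {h : ℕ} (k : Fin (2 ^ h)) (r : Regs h) (z : Str 0) : Fin 2 :=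
  z 0 + ∑ ℓ : Fin h, r ℓ ⟨k % 2 ^ (ℓ : ℕ), Nat.mod_lt _ (by positivity)⟩

/-- The final step of the user: she computes the message in an output register. -/
def outputOp {h : ℕ} (k : Fin (2 ^ h)) :
    Isom (Regs h × Str 0) ((Regs h × Str 0) × Fin 2) :=
  Isom.ofInjective (fun x => (x, outputBit k x.1 x.2)) (fun _ _ h => congrArg Prod.fst h)

/-- The rounds from index `l` on, at a point where the user has received the two qubits. She does
`pre`, which is the Hadamard transform that is left over from the previous round, and the Pauli
gate, and sends the qubits. The server does his step; if `l > 0`, he then applies the unitary `V` of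
the next round and sends the qubits, and if `l = 0`, he sends his last register. -/
def rounds {n : ℕ} : (l : ℕ) → (hl : l < n + 1) →
    (pre : Isom (Regs (n + 1)) (Regs (n + 1))) →
    Interaction (2 ^ (n + 1)) 2 (Regs (n + 1) × Qubits) (Str (n + 1) × Regs (n + 1))
  | 0, hl, pre =>
      .round (fun k => pre.tensor (pauliZ (choiceBit k ⟨0, hl⟩)))
        ((serverStep ⟨0, hl⟩).andThen sendLast)
        (.done fun k => ((hadamardAt ⟨0, hl⟩).tensor (Isom.id (Str 0))).andThen (outputOp k))
  | l + 1, hl, pre =>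
      .round (fun k => pre.tensor (pauliZ (choiceBit k ⟨l + 1, hl⟩)))
        ((serverStep ⟨l + 1, hl⟩).andThen (V ⟨l, Nat.lt_of_succ_lt hl⟩))
        (rounds l (Nat.lt_of_succ_lt hl) (hadamardAt ⟨l + 1, hl⟩))

/-- The maximally entangled state `2^(-2^l/2) * ∑_z |z⟩|z⟩` of two strings. -/
def epr (l : ℕ) (z z' : Str l) : ℂ :=
  if z = z' then (((Real.sqrt (2 ^ 2 ^ l))⁻¹ : ℝ) : ℂ) else 0

/-- The shared initial state: maximally entangled states, and `|0⟩|0⟩` on the server's qubits. -/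
def initial (h : ℕ) (x : Regs h × (Qubits × Regs h)) : ℂ :=
  (∏ ℓ : Fin h, epr ℓ (x.2.2 ℓ) (x.1 ℓ)) * if x.2.1 = (0, 0) then 1 else 0

theorem epr_sum (l : ℕ) (z : Str l) : ∑ z', ‖epr l z' z‖ ^ 2 = (2 ^ 2 ^ l : ℝ)⁻¹ := by
  have h : ∀ z', ‖epr l z' z‖ ^ 2 = if z' = z then (2 ^ 2 ^ l : ℝ)⁻¹ else 0 := by
    intro z'
    unfold epr
    split_ifs
    · rw [Complex.norm_real, Real.norm_eq_abs, sq_abs, inv_pow, Real.sq_sqrt (by positivity)]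
    · simp
  simp [h]

theorem initial_norm (h : ℕ) : ∑ x, ‖initial h x‖ ^ 2 = 1 := by
  have h1 : ∀ (u : Regs h) (b : Qubits) (r : Regs h), ‖initial h (u, b, r)‖ ^ 2 =
      if b = (0, 0) then ∏ ℓ : Fin h, ‖epr ℓ (r ℓ) (u ℓ)‖ ^ 2 else 0 := by
    intro u b r
    unfold initial
    split_ifs with hb
    · simp [norm_prod, Finset.prod_pow]
    · simp
  rw [Fintype.sum_prod_type]
  have h2 : ∀ u : Regs h, ∑ y : Qubits × Regs h, ‖initial h (u, y)‖ ^ 2 =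
      ∏ ℓ : Fin h, (2 ^ 2 ^ (ℓ : ℕ) : ℝ)⁻¹ := by
    intro u
    rw [Fintype.sum_prod_type_right]
    simp only [h1, Finset.sum_ite_eq', Finset.mem_univ, if_true]
    rw [← Fintype.prod_sum (fun (ℓ : Fin h) (z : Str ℓ) => ‖epr ℓ z (u ℓ)‖ ^ 2)]
    simp only [epr_sum]
  simp only [h2, Finset.sum_const, Finset.card_univ, nsmul_eq_mul]
  rw [Fintype.card_pi]
  push_cast
  rw [← Finset.prod_mul_distrib]
  refine Finset.prod_eq_one fun ℓ _ => ?_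
  simp

/-- The operation of the server before his first message. -/
def firstOp (n : ℕ) :
    Isom (Unit × (Str (n + 1) × (Qubits × Regs (n + 1))))
      (Qubits × (Str (n + 1) × Regs (n + 1))) :=
  (Isom.ofEquiv
    { toFun := fun x => (x.2.2.1, x.2.1, x.2.2.2)
      invFun := fun x => ((), x.2.1, x.1, x.2.2)
      left_inv := fun _ => rfl
      right_inv := fun _ => rfl }).andThen (V (Fin.last n))

/-- The one-server protocol with prior entanglement for `2 ^ (n + 1)` one-bit messages. The server
speaks first, so that the query of the first round is trivial. -/
def protocol (n : ℕ) : Protocol (2 ^ (n + 1)) 2 where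
  Ru := Regs (n + 1)
  Rs := Qubits × Regs (n + 1)
  init := initial (n + 1)
  init_norm := initial_norm (n + 1)
  body := .round (fun _ => Isom.ofEquiv (Equiv.prodPUnit _).symm) (firstOp n)
    (rounds n (Nat.lt_succ_self n) (Isom.id _))

end Entangled

end QPIR

end

/-! The two protocols are treated by one principle: against specious attacks, secrecy in every round
already follows from secrecy in every round of the honest execution, because the honest global state
is pure when the inputs are classical.

Let an operation of the server with Kraus operators `F_e` turn the attacked state `ρ'` into the pure
honest state `ρ`. A pure state is extremal, so every block `F_e ρ' F_{e'}ᴴ` is a multiple of `ρ`,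
and its coefficient is a trace that only sees the server's reduced state
(`IsPure.mul_mul_conjTranspose`). Since `∑ F_eᴴ F_e = 1`, `ρ'` is a combination of the terms `F_eᴴ ρ
F_{e'}` with these coefficients (`eq_sum_of_onServer_isPure`). The user's next operation commutes
with the `F_e`. Hence the attacker's state after the next query is a function of his previous
reduced state and of the honest server's state after that query
(`serverState_sendQuery_eq_of_onServer_isPure`). If neither depends on the choice, neither does the
attacker's new state, and induction over the rounds gives
`Interaction.Attack.hidesChoice_of_isSpecious`.

It remains to examine the honest executions. In Protocol A the user keeps a copy of all queries, so
the server sees a classical mixture of single queries, whose distribution is private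
(`ClassicalPIR.sum_stateVector`). In Protocol B the server's state with the two qubits is diagonal,
so the user's `Z` leaves it fixed; the second `V` undoes the first, and the Hadamard gates preserve
the completely mixed state (`Entangled.rounds_hidesChoice`). -/

noncomputable section

namespace QPIR

open scoped ComplexOrder

set_option linter.unusedSectionVars false

/-! ### Reduced states of the server and their behaviour under queries and answers. -/

section Reduced

variable {W U Q A S S' T : Type} [Fintype W] [Fintype U] [Fintype Q] [Fintype A] [Fintype S]
  [Fintype S'] [Fintype T]

theorem serverState_smul (c : ℂ) (ρ : Matrix (W × S) (W × S) ℂ) :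
    serverState (c • ρ) = c • serverState ρ := by
  ext s s'
  simp [serverState, Finset.mul_sum]

theorem serverState_sum {ε : Type*} (t : Finset ε) (ρ : ε → Matrix (W × S) (W × S) ℂ) :
    serverState (∑ e ∈ t, ρ e) = ∑ e ∈ t, serverState (ρ e) := by
  ext s s'
  simp only [serverState, Matrix.sum_apply, Matrix.of_apply]
  exact Finset.sum_comm

theorem trace_serverState (ρ : Matrix (W × S) (W × S) ℂ) :
    (serverState ρ).trace = ρ.trace := by
  simp only [serverState, Matrix.trace, Matrix.diag_apply, Matrix.of_apply,
    Fintype.sum_prod_type_right]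

open Classical in
/-- A map of the first system that is inverted on the other side does not change the reduced
state of the second system. -/
theorem serverState_kronecker_mul (A : Matrix U W ℂ) (A' : Matrix W U ℂ) (h : A' * A = 1)
    (X : Matrix T S ℂ) (Y : Matrix S T ℂ) (ρ : Matrix (W × S) (W × S) ℂ) :
    serverState ((A ⊗ₖ X) * ρ * (A' ⊗ₖ Y)) = X * serverState ρ * Y := by
  ext t t'
  -- Tracing out `U` contracts `A` with `A'` cyclically, which leaves a Kronecker delta on `W`, that
  -- is, the partial trace of `ρ`.
  have key : ∀ w w' : W, ∑ u, A u w * A' w' u = if w' = w then 1 else 0 := by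
    intro w w'
    have := congrFun (congrFun h w') w
    rw [Matrix.mul_apply, Matrix.one_apply] at this
    rw [← this]
    exact Finset.sum_congr rfl fun _ _ => mul_comm _ _
  simp only [serverState, Matrix.of_apply, Matrix.mul_apply, Matrix.kronecker_apply,
    Fintype.sum_prod_type, Finset.sum_mul, Finset.mul_sum]
  calc _ = ∑ w', ∑ s', ∑ w, ∑ s, (∑ u, A u w * A' w' u) * (X t s * ρ (w, s) (w', s') * Y s' t') := by
        rw [Finset.sum_comm]
        refine Finset.sum_congr rfl fun w' _ => ?_
        rw [Finset.sum_comm]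
        refine Finset.sum_congr rfl fun s' _ => ?_
        rw [Finset.sum_comm]
        refine Finset.sum_congr rfl fun w _ => ?_
        rw [Finset.sum_comm]
        refine Finset.sum_congr rfl fun s _ => ?_
        rw [Finset.sum_mul]
        exact Finset.sum_congr rfl fun u _ => by ring
    _ = _ := by
        simp only [key, ite_mul, one_mul, zero_mul]
        rw [Finset.sum_comm]
        refine Finset.sum_congr rfl fun s' _ => ?_
        have : ∀ w' : W, (∑ w, ∑ s, if w' = w then X t s * ρ (w, s) (w', s') * Y s' t' else 0) =
            ∑ s, X t s * ρ (w', s) (w', s') * Y s' t' := fun w' => by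
          rw [Finset.sum_comm]; simp
        simp only [this]
        exact Finset.sum_comm

/-- The reduced state on the answer register and the server's memory. -/
def answerState (ρ : Matrix ((U × A) × S) ((U × A) × S) ℂ) : Matrix (A × S) (A × S) ℂ :=
  serverState (Matrix.reindex (Equiv.prodAssoc U A S) (Equiv.prodAssoc U A S) ρ)

theorem serverState_eq_serverState_answerState (ρ : Matrix ((U × A) × S) ((U × A) × S) ℂ) :
    serverState ρ = serverState (answerState ρ) := by
  ext s s'
  simp only [serverState, answerState, Matrix.of_apply, Matrix.reindex_apply,
    Matrix.submatrix_apply, Fintype.sum_prod_type, Equiv.prodAssoc_symm_apply]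
  exact Finset.sum_comm

/-- The operation does not touch `U`, so it commutes with tracing out `U`. The answer register stays
in the description although the user now holds it. -/
theorem answerState_sendAnswer (Φ : Channel (Q × S) (A × S'))
    (ρ : Matrix (U × (Q × S)) (U × (Q × S)) ℂ) :
    answerState (sendAnswer Φ ρ) = ∑ e, Φ.kraus e * serverState ρ * (Φ.kraus e)ᴴ := by
  classical
  have h : answerState (sendAnswer Φ ρ) = serverState (Φ.onServer ρ) := by
    ext x y
    simp [answerState, sendAnswer]
  rw [h, Channel.onServer, serverState_sum]
  refine Finset.sum_congr rfl fun e _ => ?_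
  rw [Matrix.conjTranspose_kronecker]
  exact serverState_kronecker_mul _ _ (by simp) _ _ _

/-- Carries the equality of the attacker's states across his own move in the induction over rounds.
-/
theorem serverState_sendAnswer_congr (Φ : Channel (Q × S) (A × S'))
    {ρ σ : Matrix (U × (Q × S)) (U × (Q × S)) ℂ} (h : serverState ρ = serverState σ) :
    serverState (sendAnswer Φ ρ) = serverState (sendAnswer Φ σ) := by
  rw [serverState_eq_serverState_answerState, serverState_eq_serverState_answerState,
    answerState_sendAnswer, answerState_sendAnswer, h]

theorem sendQuery_smul (V : Isom W (U × Q)) (c : ℂ) (ρ : Matrix (W × S) (W × S) ℂ) :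
    sendQuery V (c • ρ) = c • sendQuery V ρ := by
  simp [sendQuery, Matrix.submatrix_smul]

theorem sendQuery_sum {ε : Type*} (t : Finset ε) (V : Isom W (U × Q))
    (ρ : ε → Matrix (W × S) (W × S) ℂ) :
    sendQuery V (∑ e ∈ t, ρ e) = ∑ e ∈ t, sendQuery V (ρ e) := by
  ext x y
  simp [sendQuery, Matrix.mul_sum, Matrix.sum_mul, Matrix.sum_apply]

open Classical in
theorem kronecker_assoc_one (L : Matrix T S ℂ) :
    ((1 : Matrix U U ℂ) ⊗ₖ ((1 : Matrix Q Q ℂ) ⊗ₖ L)) =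
      Matrix.reindex (Equiv.prodAssoc U Q T) (Equiv.prodAssoc U Q S)
        ((1 : Matrix (U × Q) (U × Q) ℂ) ⊗ₖ L) := by
  rw [← Matrix.one_kronecker_one, Matrix.kronecker_assoc]

open Classical in
/-- The operation of the user commutes with operations on the server's system. -/
theorem sendQuery_kronecker_mul (V : Isom W (U × Q)) (L : Matrix T S ℂ) (R : Matrix S T ℂ)
    (ρ : Matrix (W × S) (W × S) ℂ) :
    sendQuery V (((1 : Matrix W W ℂ) ⊗ₖ L) * ρ * ((1 : Matrix W W ℂ) ⊗ₖ R)) =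
      ((1 : Matrix U U ℂ) ⊗ₖ ((1 : Matrix Q Q ℂ) ⊗ₖ L)) * sendQuery V ρ *
        ((1 : Matrix U U ℂ) ⊗ₖ ((1 : Matrix Q Q ℂ) ⊗ₖ R)) := by
  have h1 : (V.mat ⊗ₖ (1 : Matrix T T ℂ)) * ((1 : Matrix W W ℂ) ⊗ₖ L) =
      ((1 : Matrix (U × Q) (U × Q) ℂ) ⊗ₖ L) * (V.mat ⊗ₖ (1 : Matrix S S ℂ)) := by
    rw [← Matrix.mul_kronecker_mul, ← Matrix.mul_kronecker_mul]; simp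
  have h2 : ((1 : Matrix W W ℂ) ⊗ₖ R) * (V.mat ⊗ₖ (1 : Matrix T T ℂ))ᴴ =
      (V.mat ⊗ₖ (1 : Matrix S S ℂ))ᴴ * ((1 : Matrix (U × Q) (U × Q) ℂ) ⊗ₖ R) := by
    rw [Matrix.conjTranspose_kronecker, Matrix.conjTranspose_kronecker,
      ← Matrix.mul_kronecker_mul, ← Matrix.mul_kronecker_mul]; simp
  rw [kronecker_assoc_one, kronecker_assoc_one, sendQuery, sendQuery]
  simp only [Matrix.reindex_apply, Matrix.submatrix_mul_equiv]
  congr 1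
  calc _ = ((V.mat ⊗ₖ (1 : Matrix T T ℂ)) * ((1 : Matrix W W ℂ) ⊗ₖ L)) * ρ *
        (((1 : Matrix W W ℂ) ⊗ₖ R) * (V.mat ⊗ₖ (1 : Matrix T T ℂ))ᴴ) := by
        simp only [Matrix.mul_assoc]
    _ = _ := by rw [h1, h2]; simp only [Matrix.mul_assoc]

open Classical in
theorem serverState_sendQuery_kronecker_mul (V : Isom W (U × Q)) (L : Matrix T S ℂ)
    (R : Matrix S T ℂ) (ρ : Matrix (W × S) (W × S) ℂ) :
    serverState (sendQuery V (((1 : Matrix W W ℂ) ⊗ₖ L) * ρ * ((1 : Matrix W W ℂ) ⊗ₖ R))) =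
      ((1 : Matrix Q Q ℂ) ⊗ₖ L) * serverState (sendQuery V ρ) * ((1 : Matrix Q Q ℂ) ⊗ₖ R) := by
  rw [sendQuery_kronecker_mul]
  exact serverState_kronecker_mul _ _ (by simp) _ _ _

/-- `V` acts only on what the user keeps and disappears under the partial trace; only the action `Z`
on the returned register is visible. This is the form of the user's moves in Protocol B. -/
theorem serverState_sendQuery_tensor {U' Q' : Type} [Fintype U'] [Fintype Q']
    (V : Isom U' U) (Z : Isom Q' Q) (ρ : Matrix ((U' × Q') × S) ((U' × Q') × S) ℂ)
    [DecidableEq S] :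
    serverState (sendQuery (V.tensor Z) ρ) =
      (Z.mat ⊗ₖ (1 : Matrix S S ℂ)) * answerState ρ * (Z.mat ⊗ₖ (1 : Matrix S S ℂ))ᴴ := by
  classical
  rw [answerState, ← serverState_kronecker_mul V.mat V.matᴴ V.isometry]
  congr 1
  rw [← Matrix.conjTranspose_kronecker, sendQuery, ← Matrix.kronecker_assoc]
  simp only [Matrix.reindex_apply, Matrix.conjTranspose_submatrix, Matrix.submatrix_mul_equiv]
  congr!

/-! ### Positivity, purity and recovery of an attacked state from the honest one. -/

theorem posSemidef_sendQuery (V : Isom W (U × Q)) {ρ : Matrix (W × S) (W × S) ℂ}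
    (h : ρ.PosSemidef) : (sendQuery V ρ).PosSemidef := by
  classical
  exact (h.mul_mul_conjTranspose_same _).submatrix _

theorem posSemidef_sendAnswer (Φ : Channel (Q × S) (A × S'))
    {ρ : Matrix (U × (Q × S)) (U × (Q × S)) ℂ} (h : ρ.PosSemidef) :
    (sendAnswer Φ ρ).PosSemidef := by
  classical
  exact (Matrix.posSemidef_sum _ fun e _ => h.mul_mul_conjTranspose_same _).submatrix _

/-- A pure state. -/
def IsPure {m : Type} [Fintype m] (ρ : Matrix m m ℂ) : Prop :=
  ∃ ψ : m → ℂ, star ψ ⬝ᵥ ψ = 1 ∧ ρ = Matrix.vecMulVec ψ (star ψ)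

theorem IsPure.posSemidef {m : Type} [Fintype m] {ρ : Matrix m m ℂ} (h : IsPure ρ) :
    ρ.PosSemidef := by
  obtain ⟨ψ, -, rfl⟩ := h
  exact Matrix.posSemidef_vecMulVec_self_star ψ

theorem IsPure.isHermitian {m : Type} [Fintype m] {ρ : Matrix m m ℂ} (h : IsPure ρ) :
    ρᴴ = ρ := by
  obtain ⟨ψ, h1, rfl⟩ := h
  rw [Matrix.conjTranspose_vecMulVec, star_star]

/-- Compression to a line is multiplication by a scalar, here `⟨ψ|X|ψ⟩`. -/
theorem IsPure.mul_mul {m : Type} [Fintype m] {ρ : Matrix m m ℂ} (h : IsPure ρ)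
    (X : Matrix m m ℂ) : ρ * X * ρ = (ρ * X * ρ).trace • ρ := by
  obtain ⟨ψ, h1, rfl⟩ := h
  rw [Matrix.vecMulVec_mul, Matrix.vecMulVec_mul_vecMulVec, Matrix.vecMulVec_smul,
    Matrix.trace_smul, Matrix.trace_vecMulVec, dotProduct_comm ψ, h1, smul_eq_mul, mul_one]

theorem IsPure.conj {m n : Type} [Fintype m] [Fintype n] [DecidableEq m] {ρ : Matrix m m ℂ}
    (h : IsPure ρ) (M : Matrix n m ℂ) (hM : Mᴴ * M = 1) : IsPure (M * ρ * Mᴴ) := by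
  obtain ⟨ψ, h1, rfl⟩ := h
  refine ⟨M *ᵥ ψ, ?_, ?_⟩
  · rw [Matrix.star_mulVec, ← Matrix.dotProduct_mulVec, Matrix.mulVec_mulVec, hM,
      Matrix.one_mulVec, h1]
  · rw [Matrix.mul_vecMulVec, Matrix.vecMulVec_mul, Matrix.star_mulVec]

theorem IsPure.reindex {m n : Type} [Fintype m] [Fintype n] {ρ : Matrix m m ℂ}
    (h : IsPure ρ) (e : m ≃ n) : IsPure (Matrix.reindex e e ρ) := by
  obtain ⟨ψ, h1, rfl⟩ := h
  refine ⟨ψ ∘ e.symm, ?_, ?_⟩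
  · rw [← h1]
    exact Equiv.sum_comp e.symm fun x => star ψ x * ψ x
  · ext x y
    simp [Matrix.vecMulVec_apply]

theorem IsPure.sendQuery (V : Isom W (U × Q)) {ρ : Matrix (W × S) (W × S) ℂ} (h : IsPure ρ) :
    IsPure (sendQuery V ρ) := by
  classical
  refine (h.conj _ ?_).reindex _
  rw [Matrix.conjTranspose_kronecker, ← Matrix.mul_kronecker_mul, V.isometry]
  simp

theorem IsPure.sendAnswer (V : Isom (Q × S) (A × S'))
    {ρ : Matrix (U × (Q × S)) (U × (Q × S)) ℂ} (h : IsPure ρ) :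
    IsPure (sendAnswer V.toChannel ρ) := by
  classical
  have h1 : V.toChannel.onServer ρ =
      ((1 : Matrix U U ℂ) ⊗ₖ V.mat) * ρ * ((1 : Matrix U U ℂ) ⊗ₖ V.mat)ᴴ := by
    refine (Fin.sum_univ_one _).trans ?_
    congr!
  refine IsPure.reindex ?_ _
  rw [h1]
  refine h.conj _ ?_
  rw [Matrix.conjTranspose_kronecker, ← Matrix.mul_kronecker_mul]
  convert Matrix.one_kronecker_one (α := ℂ) (m := U) (n := Q × S) using 2
  · simp
  · rw [V.isometry]
    congr!

/-- Each diagonal entry of the sum is a sum of squared moduli of entries of the `D e`. -/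
theorem eq_zero_of_sum_mul_conjTranspose {ε m n : Type*} [Fintype ε] [Fintype n]
    (D : ε → Matrix m n ℂ) (h : ∑ e, D e * (D e)ᴴ = 0) (e : ε) : D e = 0 := by
  ext i j
  have h1 : ∑ e, ∑ j, Complex.normSq (D e i j) = 0 := by
    have := congrFun (congrFun h i) i
    simp only [Matrix.sum_apply, Matrix.mul_apply, Matrix.conjTranspose_apply, RCLike.star_def,
      Complex.mul_conj, Matrix.zero_apply] at this
    exact_mod_cast this
  have h2 := (Finset.sum_eq_zero_iff_of_nonneg fun e _ =>
    Finset.sum_nonneg fun j _ => Complex.normSq_nonneg _).1 h1 e (Finset.mem_univ _)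
  have h3 := (Finset.sum_eq_zero_iff_of_nonneg fun j _ => Complex.normSq_nonneg _).1 h2 j
    (Finset.mem_univ _)
  simpa using h3

/-- If a sum `∑ e, C e * ρ * (C e)ᴴ` is pure, then `ρ` is a product with it in the dilated
space. -/
theorem IsPure.mul_mul_conjTranspose {ε m n : Type} [Fintype ε] [Fintype m] [Fintype n]
    {ρ : Matrix n n ℂ} (hρ : ρ.PosSemidef) {C : ε → Matrix m n ℂ} {P : Matrix m m ℂ}
    (hP : IsPure P) (h : ∑ e, C e * ρ * (C e)ᴴ = P) (e e' : ε) :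
    C e * ρ * (C e')ᴴ = (C e * ρ * (C e')ᴴ).trace • P := by
  classical
  -- With `ρ = B Bᴴ` each summand becomes `(C e B)(C e B)ᴴ`, so a vanishing sum forces each factor
  -- to vanish.
  obtain ⟨N, B, rfl⟩ : ∃ (N : ℕ) (B : Matrix n (Fin N) ℂ), ρ = B * Bᴴ := by
    obtain ⟨N, v, rfl⟩ := Matrix.posSemidef_iff_eq_sum_vecMulVec.1 hρ
    refine ⟨N, Matrix.of fun x i => v i x, ?_⟩
    ext x y
    simp [Matrix.sum_apply, Matrix.mul_apply, Matrix.vecMulVec_apply]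
  have hPP : P * P = P := by
    obtain ⟨ψ, h2, rfl⟩ := hP
    rw [Matrix.vecMulVec_mul_vecMulVec, h2, one_smul]
  -- The range of every `C e * B` lies in the line onto which `P` projects, since the sum compressed
  -- by `1 - P` is `(1 - P) P (1 - P) = 0`.
  have hD : ∀ e, (1 - P) * (C e * B) = 0 := by
    refine eq_zero_of_sum_mul_conjTranspose _ ?_
    calc ∑ e, (1 - P) * (C e * B) * ((1 - P) * (C e * B))ᴴ
        = (1 - P) * (∑ e, C e * (B * Bᴴ) * (C e)ᴴ) * (1 - P)ᴴ := by
          rw [Matrix.mul_sum, Matrix.sum_mul]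
          simp only [Matrix.conjTranspose_mul, Matrix.mul_assoc]
      _ = 0 := by rw [h, sub_mul, hPP]; simp
  have hC : ∀ e, C e * B = P * (C e * B) := fun e => by
    have := hD e
    rwa [Matrix.sub_mul, Matrix.one_mul, sub_eq_zero] at this
  have hX : C e * (B * Bᴴ) * (C e')ᴴ = P * (C e * B * (C e' * B)ᴴ) * P := by
    calc C e * (B * Bᴴ) * (C e')ᴴ = (C e * B) * (C e' * B)ᴴ := by
          simp only [Matrix.conjTranspose_mul, Matrix.mul_assoc]
      _ = (P * (C e * B)) * (P * (C e' * B))ᴴ := by rw [← hC, ← hC]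
      _ = _ := by
          rw [Matrix.conjTranspose_mul P, hP.isHermitian]; simp only [Matrix.mul_assoc]
  rw [hX]
  exact hP.mul_mul _

open Classical in
/-- A state that some operation of the server turns into the pure state `ρ` is recovered from `ρ`
with coefficients that depend only on the reduced state of the server. -/
theorem eq_sum_of_onServer_isPure (F : Channel T S) {ρ' : Matrix (W × T) (W × T) ℂ}
    {ρ : Matrix (W × S) (W × S) ℂ} (hρ' : ρ'.PosSemidef) (hρ : IsPure ρ)
    (h : F.onServer ρ' = ρ) :
    ρ' = ∑ e, ∑ e', (F.kraus e * serverState ρ' * (F.kraus e')ᴴ).trace •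
      (((1 : Matrix W W ℂ) ⊗ₖ (F.kraus e)ᴴ) * ρ * ((1 : Matrix W W ℂ) ⊗ₖ F.kraus e')) := by
  -- Trace preservation gives a resolution of the identity, to be inserted on both sides of `ρ'`.
  have h1 : ∑ e, ((1 : Matrix W W ℂ) ⊗ₖ (F.kraus e)ᴴ) * ((1 : Matrix W W ℂ) ⊗ₖ F.kraus e) = 1 := by
    simp only [← Matrix.mul_kronecker_mul, one_mul]
    rw [← Matrix.one_kronecker_one, ← F.tracePreserving]
    ext ⟨w, t⟩ ⟨w', t'⟩
    simp [Matrix.sum_apply, Finset.mul_sum]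
  calc ρ' = (∑ e, ((1 : Matrix W W ℂ) ⊗ₖ (F.kraus e)ᴴ) * ((1 : Matrix W W ℂ) ⊗ₖ F.kraus e)) * ρ' *
        (∑ e, ((1 : Matrix W W ℂ) ⊗ₖ (F.kraus e)ᴴ) * ((1 : Matrix W W ℂ) ⊗ₖ F.kraus e)) := by
        rw [h1]; simp
    _ = _ := by
        simp only [Matrix.sum_mul, Matrix.mul_sum]
        rw [Finset.sum_comm]
        refine Finset.sum_congr rfl fun e _ => Finset.sum_congr rfl fun e' _ => ?_
        have h2 := hρ.mul_mul_conjTranspose hρ' h e e'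
        -- The coefficient is computed on the server's side alone, so it agrees for two states with
        -- the same reduced state.
        have h3 : (((1 : Matrix W W ℂ) ⊗ₖ F.kraus e) * ρ' *
            ((1 : Matrix W W ℂ) ⊗ₖ F.kraus e')ᴴ).trace =
            (F.kraus e * serverState ρ' * (F.kraus e')ᴴ).trace := by
          rw [← trace_serverState, Matrix.conjTranspose_kronecker]
          rw [serverState_kronecker_mul _ _ (by simp)]
        rw [h3] at h2
        rw [← Matrix.smul_mul, ← Matrix.mul_smul, ← h2, Matrix.conjTranspose_kronecker]
        simp [Matrix.mul_assoc]

/-- If two states have the same reduced state of the server, and some operation of the server turns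
them into pure states with the same reduced state of the server after the next query, then they
also have the same reduced state of the server after the next query. -/
theorem serverState_sendQuery_eq_of_onServer_isPure (F : Channel T S)
    {ρ₁' ρ₂' : Matrix (W × T) (W × T) ℂ} {ρ₁ ρ₂ : Matrix (W × S) (W × S) ℂ}
    (hρ₁' : ρ₁'.PosSemidef) (hρ₂' : ρ₂'.PosSemidef) (hρ₁ : IsPure ρ₁) (hρ₂ : IsPure ρ₂)
    (h₁ : F.onServer ρ₁' = ρ₁) (h₂ : F.onServer ρ₂' = ρ₂) (h' : serverState ρ₁' = serverState ρ₂')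
    (V₁ V₂ : Isom W (U × Q))
    (h : serverState (sendQuery V₁ ρ₁) = serverState (sendQuery V₂ ρ₂)) :
    serverState (sendQuery V₁ ρ₁') = serverState (sendQuery V₂ ρ₂') := by
  classical
  rw [eq_sum_of_onServer_isPure F hρ₁' hρ₁ h₁, eq_sum_of_onServer_isPure F hρ₂' hρ₂ h₂]
  simp only [sendQuery_sum, serverState_sum, sendQuery_smul, serverState_smul,
    serverState_sendQuery_kronecker_mul, h, h']

end Reduced

/-! ### Reduction of specious secrecy to the honest execution. -/

/-- The all-round criterion for the honest execution. -/
def Interaction.HidesChoice {f d : ℕ} {ι : Type} : {W S : Type} → [Fintype W] → [Fintype S] →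
    Interaction f d W S → (ρ : ι → Fin f → Matrix (W × S) (W × S) ℂ) → Prop
  | _, _, _, _, @Interaction.done _ _ _ _ _ _ _ _ _, _ => True
  | _, _, _, _, @Interaction.round _ _ _ S U Q _ _ _ _ _ _ _ _ user server next, ρ =>
      (∀ i k k', serverState (W := U) (S := Q × S) (sendQuery (user k) (ρ i k)) =
        serverState (W := U) (S := Q × S) (sendQuery (user k') (ρ i k'))) ∧
      next.HidesChoice fun i k => sendAnswer server.toChannel (sendQuery (user k) (ρ i k))

theorem Interaction.HidesChoice.comp {f d : ℕ} {ι κ : Type} {W S : Type} [Fintype W] [Fintype S]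
    {π : Interaction f d W S} {ρ : ι → Fin f → Matrix (W × S) (W × S) ℂ} (h : π.HidesChoice ρ)
    (g : κ → ι) : π.HidesChoice fun j => ρ (g j) := by
  induction π with
  | done => trivial
  | round user server next ih => exact ⟨fun j => h.1 (g j), ih h.2⟩

/-- The induction maintains four facts: the honest state is pure, the attacked state is positive,
one operation `F` of the server recovers the former from the latter for all inputs and choices, and
the attacker's reduced state hides the choice. Speciousness supplies the operation `G` that takes
the place of `F` in the next round. -/
theorem Interaction.Attack.hidesChoice_of_isSpecious {f d : ℕ} {ι : Type} {W S T : Type}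
    [Fintype W] [Fintype S] [Fintype T] {π : Interaction f d W S} (att : π.Attack T)
    (ρ : ι → Fin f → Matrix (W × S) (W × S) ℂ) (ρ' : ι → Fin f → Matrix (W × T) (W × T) ℂ)
    (hρ : ∀ i k, IsPure (ρ i k)) (hρ' : ∀ i k, (ρ' i k).PosSemidef)
    (F : Channel T S) (hF : ∀ i k, F.onServer (ρ' i k) = ρ i k)
    (hs : ∀ i k k', serverState (ρ' i k) = serverState (ρ' i k'))
    (hπ : π.HidesChoice ρ) (hatt : att.IsSpecious ρ ρ') : att.HidesChoice ρ' := by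
  induction att with
  | done => trivial
  | round Φ att ih =>
    obtain ⟨⟨G, hG⟩, hatt⟩ := hatt
    obtain ⟨hq, hπ⟩ := hπ
    have hq' := fun i k k' => serverState_sendQuery_eq_of_onServer_isPure F (hρ' i k) (hρ' i k')
      (hρ i k) (hρ i k') (hF i k) (hF i k') (hs i k k') _ _ (hq i k k')
    exact ⟨hq', ih _ _ (fun i k => ((hρ i k).sendQuery _).sendAnswer _)
      (fun i k => posSemidef_sendAnswer _ (posSemidef_sendQuery _ (hρ' i k))) G hG
      (fun i k k' => serverState_sendAnswer_congr _ (hq' i k k')) hπ hatt⟩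

/-- The vector of the initial state when the messages are `a`. -/
def Protocol.initialVector {f d : ℕ} (P : Protocol f d) (a : Messages f d)
    (x : P.Ru × (Messages f d × P.Rs)) : ℂ :=
  P.init (x.1, x.2.2) * if x.2.1 = a then 1 else 0

/-- Classical messages are a basis vector, so the global initial state has rank one; this is the
source of purity for the whole argument. -/
theorem Protocol.initialState_single {f d : ℕ} (P : Protocol f d) (a : Messages f d) :
    P.initialState (fun l => Matrix.single (a l) (a l) 1) =
      Matrix.vecMulVec (P.initialVector a) (star (P.initialVector a)) := by
  ext x y
  have h : productState (fun l => Matrix.single (a l) (a l) (1 : ℂ)) x.2.1 y.2.1 =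
      (if x.2.1 = a then 1 else 0) * if y.2.1 = a then 1 else 0 := by
    simp only [productState, Matrix.of_apply, Matrix.single_apply]
    rw [Finset.prod_ite_zero]
    simp only [Finset.prod_const_one, Finset.mem_univ, true_imp_iff, forall_and, funext_iff,
      eq_comm, ite_zero_mul_ite_zero, mul_one]
  simp only [initialState, Matrix.of_apply, h, Matrix.vecMulVec_apply, initialVector,
    Pi.star_apply, star_mul']
  split_ifs <;> simp

theorem Protocol.initialVector_norm {f d : ℕ} (P : Protocol f d) (a : Messages f d) :
    star (P.initialVector a) ⬝ᵥ P.initialVector a = 1 := by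
  have h1 : ∑ x, star (P.init x) * P.init x = 1 := by
    have := P.init_norm
    simp only [RCLike.star_def, Complex.conj_mul']
    exact_mod_cast this
  rw [← h1]
  simp only [dotProduct, Fintype.sum_prod_type, Pi.star_apply, initialVector]
  refine Finset.sum_congr rfl fun u _ => ?_
  rw [Finset.sum_comm]
  simp

theorem Protocol.speciousSecret_of_hidesChoice {f d : ℕ} (P : Protocol f d)
    (h : P.body.HidesChoice fun (a : Messages f d) (_ : Fin f) =>
      Matrix.vecMulVec (P.initialVector a) (star (P.initialVector a))) :
    P.SpeciousSecret (classicalInputs d) := by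
  classical
  let ρ := fun (i : {ρ : Fin f → Matrix (Fin d) (Fin d) ℂ // ∀ l, ρ l ∈ classicalInputs d})
    (_ : Fin f) => P.initialState i.1
  change ∀ att : P.body.Attack (Messages f d × P.Rs), att.IsSpecious ρ ρ → att.HidesChoice ρ
  intro att hatt
  have hin : ∀ i : {ρ : Fin f → Matrix (Fin d) (Fin d) ℂ // ∀ l, ρ l ∈ classicalInputs d},
      ∃ a : Messages f d, i.1 = fun l => Matrix.single (a l) (a l) 1 := fun i => by
    choose a ha using i.2
    exact ⟨a, funext fun l => (ha l).symm⟩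
  choose a ha using hin
  have hρ : ρ = fun i _ => Matrix.vecMulVec (P.initialVector (a i))
      (star (P.initialVector (a i))) := by
    funext i k
    simp only [ρ, ← P.initialState_single, ← ha]
  have hpure : ∀ i k, IsPure (ρ i k) := fun i k => by
    rw [hρ]
    exact ⟨_, P.initialVector_norm _, rfl⟩
  -- Before the first round the attacker still holds the honest state: the identity recovers it, and
  -- it does not involve the choice.
  refine att.hidesChoice_of_isSpecious ρ ρ hpure (fun i k => (hpure i k).posSemidef)
    (Isom.id _).toChannel (fun i k => ?_) (fun _ _ _ => rfl) ?_ hatt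
  · refine (Fin.sum_univ_one _).trans ?_
    simp [Isom.toChannel, Isom.id]
  · rw [hρ]
    exact h.comp a

/-! ### Permutations of the computational basis and regrouping of registers. -/

section Relabelling

variable {W X U Q A S S' m n : Type} [Fintype W] [Fintype X] [Fintype U] [Fintype Q] [Fintype A]
  [Fintype S] [Fintype S'] [Fintype m] [Fintype n]

theorem Isom.ofEquiv_mul_mul (e : m ≃ n) (M : Matrix m m ℂ) :
    (Isom.ofEquiv e).mat * M * (Isom.ofEquiv e).matᴴ = Matrix.reindex e e M := by
  classical
  have h : (Isom.ofEquiv e).mat = (1 : Matrix n n ℂ).submatrix _root_.id e := by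
    ext y x
    simp [Isom.ofEquiv, Isom.ofInjective, Matrix.one_apply]
  rw [h, Matrix.one_submatrix_mul, Matrix.conjTranspose_submatrix, Matrix.conjTranspose_one,
    Matrix.mul_submatrix_one]
  rfl

theorem Isom.ofEquiv_mat_kronecker_one [DecidableEq S] (e : m ≃ n) :
    (Isom.ofEquiv e).mat ⊗ₖ (1 : Matrix S S ℂ) =
      (Isom.ofEquiv (e.prodCongr (Equiv.refl S))).mat := by
  ext ⟨y, s⟩ ⟨x, s'⟩
  by_cases h1 : y = e x <;> by_cases h2 : s = s' <;>
    simp [Isom.ofEquiv, Isom.ofInjective, h1, h2]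

theorem Isom.one_kronecker_ofEquiv_mat [DecidableEq S] (e : m ≃ n) :
    (1 : Matrix S S ℂ) ⊗ₖ (Isom.ofEquiv e).mat =
      (Isom.ofEquiv ((Equiv.refl S).prodCongr e)).mat := by
  ext ⟨s, y⟩ ⟨s', x⟩
  by_cases h1 : y = e x <;> by_cases h2 : s = s' <;>
    simp [Isom.ofEquiv, Isom.ofInjective, h1, h2]

open Classical in
/-- The user applies `V` to her system. -/
def Isom.onUser (V : Isom W X) (ρ : Matrix (W × S) (W × S) ℂ) : Matrix (X × S) (X × S) ℂ :=
  (V.mat ⊗ₖ (1 : Matrix S S ℂ)) * ρ * (V.mat ⊗ₖ (1 : Matrix S S ℂ))ᴴ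

theorem Isom.onUser_vecMulVec_star (V : Isom W X) (φ : W × S → ℂ) (χ : X × S → ℂ)
    (h : ∀ x s, ∑ w, V.mat x w * φ (w, s) = χ (x, s)) :
    V.onUser (Matrix.vecMulVec φ (star φ)) = Matrix.vecMulVec χ (star χ) := by
  classical
  have h1 : (V.mat ⊗ₖ (1 : Matrix S S ℂ)) *ᵥ φ = χ := by
    ext ⟨x, s⟩
    rw [← h]
    simp [Matrix.mulVec, dotProduct, Fintype.sum_prod_type, Matrix.one_apply]
  rw [← h1, Matrix.star_mulVec, ← Matrix.vecMulVec_mul, ← Matrix.mul_vecMulVec, Isom.onUser]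

theorem Isom.ofEquiv_onUser (e : W ≃ X) (ρ : Matrix (W × S) (W × S) ℂ) :
    (Isom.ofEquiv e).onUser ρ =
      Matrix.reindex (e.prodCongr (Equiv.refl S)) (e.prodCongr (Equiv.refl S)) ρ := by
  classical
  rw [Isom.onUser, Isom.ofEquiv_mat_kronecker_one, Isom.ofEquiv_mul_mul]

theorem sendQuery_ofEquiv (e : W ≃ U × Q) (ρ : Matrix (W × S) (W × S) ℂ) :
    sendQuery (Isom.ofEquiv e) ρ =
      Matrix.reindex ((e.prodCongr (Equiv.refl S)).trans (Equiv.prodAssoc U Q S))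
        ((e.prodCongr (Equiv.refl S)).trans (Equiv.prodAssoc U Q S)) ρ := by
  classical
  rw [sendQuery, Isom.ofEquiv_mat_kronecker_one, Isom.ofEquiv_mul_mul]
  rfl

theorem sendQuery_andThen_ofEquiv (V : Isom W X) (e : X ≃ U × Q) (ρ : Matrix (W × S) (W × S) ℂ) :
    sendQuery (V.andThen (Isom.ofEquiv e)) ρ =
      Matrix.reindex ((e.prodCongr (Equiv.refl S)).trans (Equiv.prodAssoc U Q S))
        ((e.prodCongr (Equiv.refl S)).trans (Equiv.prodAssoc U Q S)) (V.onUser ρ) := by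
  classical
  have h : (V.andThen (Isom.ofEquiv e)).mat ⊗ₖ (1 : Matrix S S ℂ) =
      ((Isom.ofEquiv e).mat ⊗ₖ (1 : Matrix S S ℂ)) * (V.mat ⊗ₖ (1 : Matrix S S ℂ)) := by
    rw [← Matrix.mul_kronecker_mul]; simp [Isom.andThen]
  have h2 := Isom.ofEquiv_onUser e (V.onUser ρ)
  rw [Isom.onUser, Isom.onUser] at h2
  have h3 : ((V.andThen (Isom.ofEquiv e)).mat ⊗ₖ (1 : Matrix S S ℂ)) * ρ *
      ((V.andThen (Isom.ofEquiv e)).mat ⊗ₖ (1 : Matrix S S ℂ))ᴴ =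
      Matrix.reindex (e.prodCongr (Equiv.refl S)) (e.prodCongr (Equiv.refl S)) (V.onUser ρ) := by
    rw [h, Isom.onUser, Matrix.conjTranspose_mul, ← h2]
    simp only [Matrix.mul_assoc]
  rw [sendQuery, h3]
  rfl

theorem Isom.toChannel_onServer [DecidableEq U] (V : Isom S S')
    (ρ : Matrix (U × S) (U × S) ℂ) :
    V.toChannel.onServer ρ =
      ((1 : Matrix U U ℂ) ⊗ₖ V.mat) * ρ * ((1 : Matrix U U ℂ) ⊗ₖ V.mat)ᴴ := by
  refine (Fin.sum_univ_one _).trans ?_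
  congr!

theorem answerState_sendAnswer_toChannel (V : Isom (Q × S) (A × S'))
    (ρ : Matrix (U × (Q × S)) (U × (Q × S)) ℂ) :
    answerState (sendAnswer V.toChannel ρ) = V.mat * serverState ρ * V.matᴴ :=
  (answerState_sendAnswer _ _).trans (Fin.sum_univ_one _)

theorem sendAnswer_ofEquiv (e : Q × S ≃ A × S') (ρ : Matrix (U × (Q × S)) (U × (Q × S)) ℂ) :
    sendAnswer (Isom.ofEquiv e).toChannel ρ =
      Matrix.reindex (((Equiv.refl U).prodCongr e).trans (Equiv.prodAssoc U A S').symm)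
        (((Equiv.refl U).prodCongr e).trans (Equiv.prodAssoc U A S').symm) ρ := by
  classical
  rw [sendAnswer, Isom.toChannel_onServer, Isom.one_kronecker_ofEquiv_mat, Isom.ofEquiv_mul_mul]
  rfl

theorem reindex_vecMulVec_star (e : m ≃ n) (v : m → ℂ) :
    Matrix.reindex e e (Matrix.vecMulVec v (star v)) =
      Matrix.vecMulVec (v ∘ e.symm) (star (v ∘ e.symm)) := rfl

end Relabelling

/-- Lets sums weighted by query multiplicities be exchanged for sums over seeds. -/
theorem sum_card_fiber_mul {α β : Type*} [Fintype α] [Fintype β] [DecidableEq β] (φ : α → β)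
    (G : β → ℂ) :
    ∑ b, ((Finset.univ.filter fun x => φ x = b).card : ℂ) * G b = ∑ x, G (φ x) := by
  simp only [Finset.card_filter, Nat.cast_sum, Finset.sum_mul]
  rw [Finset.sum_comm]
  simp

/-! ### Honest execution of Protocol A. -/

namespace ClassicalPIR

variable {f s : ℕ} (C : ClassicalPIR f s)

theorem split_apply (t : Fin s) (q : C.Queries) (p : (t : Fin s) → C.Pair t) :
    C.split t (q, p) = ((q, fun j : {j : Fin s // j ≠ t} => p j), p t) := rfl

theorem split_symm_eq_iff (t : Fin s) (y : C.Rest t × C.Pair t) (p : (t : Fin s) → C.Pair t) :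
    ((C.split t).symm y).2 = p ↔ (y.1.2 = fun j : {j : Fin s // j ≠ t} => p j) ∧ y.2 = p t := by
  have h : ((C.split t).symm y).2 = p ↔ (C.split t).symm y = (y.1.1, p) :=
    ⟨fun h => Prod.ext rfl h, fun h => by rw [h]⟩
  rw [h, Equiv.symm_apply_eq, split_apply, Prod.ext_iff, Prod.ext_iff]
  simp

theorem split_symm_fst (t : Fin s) (y : C.Rest t × C.Pair t) :
    ((C.split t).symm y).1 = y.1.1 := rfl

open Classical in
/-- The contents of the registers `𝖰_t, 𝖠𝗇𝗌_t` once the servers in `D` have answered. -/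
def pairs (a : Messages f 2) (D : Set (Fin s)) (q : C.Queries) (t : Fin s) : C.Pair t :=
  (q t, if t ∈ D then C.answer t a (q t) else 0)

/-- The state vector, up to regrouping of registers, once the servers in `D` have answered. -/
def stateVector (a : Messages f 2) (k : Fin f) (D : Set (Fin s))
    (x : C.Full × (Messages f 2 × Unit)) : ℂ :=
  if x.2.1 = a ∧ x.1.2 = C.pairs a D x.1.1 then
    ((Real.sqrt ((C.multiplicity k x.1.1 : ℝ) / C.seeds) : ℝ) : ℂ) else 0

/-- The relabelling of the basis that the server's operation is. -/
def serverEquiv (t : Fin s) :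
    C.Pair t × (Messages f 2 × Unit) ≃ C.Pair t × (Messages f 2 × Unit) where
  toFun x := ((x.1.1, x.1.2 + C.answer t x.2.1 x.1.1), x.2)
  invFun x := ((x.1.1, x.1.2 - C.answer t x.2.1 x.1.1), x.2)
  left_inv x := by simp
  right_inv x := by simp

theorem serverOp_eq_ofEquiv (t : Fin s) : C.serverOp t = Isom.ofEquiv (C.serverEquiv t) := rfl

theorem pairs_self_of_notMem (a : Messages f 2) {D : Set (Fin s)} {t : Fin s} (ht : t ∉ D)
    (q : C.Queries) : C.pairs a D q t = (q t, 0) := by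
  simp [pairs, ht]

/-- The operation permutes the basis, so the new vector is the old one at the preimage. As `t ∉ D`,
the answer register held `0` and now holds exactly the answer. -/
theorem stateVector_insert (a : Messages f 2) (k : Fin f) {D : Set (Fin s)} {t : Fin s}
    (ht : t ∉ D) (x : C.Full × (Messages f 2 × Unit)) :
    C.stateVector a k D ((C.split t).symm ((C.split t x.1).1,
      ((C.serverEquiv t).symm ((C.split t x.1).2, x.2)).1), x.2) =
      C.stateVector a k (insert t D) x := by
  obtain ⟨⟨q, p⟩, a', u⟩ := x
  unfold stateVector
  refine if_congr ?_ rfl rfl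
  refine and_congr_right fun ha => ?_
  obtain rfl : a' = a := ha
  rw [split_symm_eq_iff]
  have h : p = C.pairs a' (insert t D) q ↔
      C.split t (q, p) = C.split t (q, C.pairs a' (insert t D) q) := by
    rw [(C.split t).injective.eq_iff]
    simp
  simp only [split_symm_fst]
  rw [h]
  simp only [split_apply, Prod.mk.injEq, true_and, pairs_self_of_notMem C a' ht]
  refine and_congr ?_ ?_
  · have : ∀ j : {j : Fin s // j ≠ t}, C.pairs a' (insert t D) q j = C.pairs a' D q j := fun j => by
      classical
      refine Prod.ext rfl ?_
      simp only [pairs, Set.mem_insert_iff, j.2, false_or]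
    simp only [this]
  · simp only [serverEquiv, Equiv.coe_fn_symm_mk, pairs, Set.mem_insert_iff, true_or, if_true]
    -- One side takes the answer at the query stored in the pair, the other at `q t`; equality of
    -- the first components reconciles them.
    rw [Prod.ext_iff, Prod.ext_iff, sub_eq_zero]
    constructor
    · rintro ⟨h1, h2⟩
      exact ⟨h1, h2.trans (congrArg _ h1)⟩
    · rintro ⟨h1, h2⟩
      exact ⟨h1, h2.trans (congrArg _ h1.symm)⟩

/-- The traced-out register `𝖰` records the whole tuple, so no coherence between different tuples
survives. What remains is a mixture over the `t`-th query, with an answer register still in `0`, and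
its weights are the private marginal distribution. -/
theorem sum_stateVector (a : Messages f 2) (k k' : Fin f) {D : Set (Fin s)} {t : Fin s}
    (ht : t ∉ D) (x y : C.Pair t × (Messages f 2 × Unit)) :
    ∑ r, C.stateVector a k D ((C.split t).symm (r, x.1), x.2) *
        star (C.stateVector a k D ((C.split t).symm (r, y.1), y.2)) =
      ∑ r, C.stateVector a k' D ((C.split t).symm (r, x.1), x.2) *
        star (C.stateVector a k' D ((C.split t).symm (r, y.1), y.2)) := by
  classical
  let G : C.Query t → ℂ := fun q =>
    if (x.2.1 = a ∧ x.1 = (q, 0)) ∧ (y.2.1 = a ∧ y.1 = (q, 0)) then 1 / (C.seeds : ℂ) else 0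
  have key : ∀ k, ∑ r, C.stateVector a k D ((C.split t).symm (r, x.1), x.2) *
        star (C.stateVector a k D ((C.split t).symm (r, y.1), y.2)) =
      ∑ q, ((Finset.univ.filter fun g => C.query t g k = q).card : ℂ) * G q := by
    intro k
    -- The seeds mediate between the marginal of the `t`-th query and the joint distribution of all
    -- queries.
    rw [sum_card_fiber_mul (fun g => C.query t g k) G,
      ← sum_card_fiber_mul (fun g t => C.query t g k) fun q => G (q t), Fintype.sum_prod_type]
    refine Finset.sum_congr rfl fun q _ => ?_
    have hsq : ((Real.sqrt ((C.multiplicity k q : ℝ) / C.seeds) : ℝ) : ℂ) *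
        ((Real.sqrt ((C.multiplicity k q : ℝ) / C.seeds) : ℝ) : ℂ) =
        (C.multiplicity k q : ℂ) * (1 / C.seeds) := by
      rw [← Complex.ofReal_mul, Real.mul_self_sqrt (by positivity)]
      push_cast
      ring
    -- Once `q` is fixed, only one content of the other pairs has nonzero amplitude.
    rw [Finset.sum_eq_single (fun j : {j : Fin s // j ≠ t} => C.pairs a D q j)]
    · simp only [stateVector, split_symm_eq_iff, split_symm_fst, C.pairs_self_of_notMem a ht,
        true_and, G]
      by_cases h1 : x.2.1 = a ∧ x.1 = (q t, 0)
      · by_cases h2 : y.2.1 = a ∧ y.1 = (q t, 0)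
        · rw [if_pos h1, if_pos h2, if_pos ⟨h1, h2⟩, RCLike.star_def, Complex.conj_ofReal, hsq]
          rfl
        · rw [if_neg h2, if_neg fun h : (_ ∧ x.1 = (q t, 0)) ∧ _ ∧ y.1 = (q t, 0) => h2 h.2]
          simp
      · rw [if_neg h1, if_neg fun h : (_ ∧ x.1 = (q t, 0)) ∧ _ ∧ y.1 = (q t, 0) => h1 h.1]
        simp
    · intro o _ ho
      simp [stateVector, split_symm_eq_iff, split_symm_fst, ho]
    · simp
  rw [key, key]
  exact Finset.sum_congr rfl fun q _ => by rw [C.private_query t k k' q]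

/-- `D` collects the servers already simulated. The invariant is stated after `pre`, so that it
covers both the state preparation of the first round and the mere regrouping in later ones. -/
theorem rounds_hidesChoice (ts : List (Fin s)) (hts : ts.Nodup) {W : Type} [Fintype W]
    (pre : Fin f → Isom W C.Full) (D : Set (Fin s)) (hD : ∀ t ∈ ts, t ∉ D)
    (ρ : Messages f 2 → Fin f → Matrix (W × (Messages f 2 × Unit)) (W × (Messages f 2 × Unit)) ℂ)
    (hρ : ∀ a k, (pre k).onUser (ρ a k) =
      Matrix.vecMulVec (C.stateVector a k D) (star (C.stateVector a k D))) :
    (C.rounds pre ts).HidesChoice ρ := by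
  induction ts generalizing W D with
  | nil => trivial
  | cons t ts ih =>
    have ht : t ∉ D := hD t (by simp)
    have hq : ∀ a k, sendQuery ((pre k).andThen (Isom.ofEquiv (C.split t))) (ρ a k) = _ :=
      fun a k => sendQuery_andThen_ofEquiv _ _ _
    simp only [hρ, reindex_vecMulVec_star] at hq
    refine ⟨fun a k k' => ?_, ?_⟩
    · rw [hq, hq]
      ext x y
      exact C.sum_stateVector a k k' ht x y
    · refine ih (List.nodup_cons.1 hts).2 _ (insert t D) (fun t' ht' => ?_) _ fun a k => ?_
      · rw [Set.mem_insert_iff, not_or]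
        exact ⟨fun h => (List.nodup_cons.1 hts).1 (h ▸ ht'), hD t' (by simp [ht'])⟩
      · rw [hq, serverOp_eq_ofEquiv, sendAnswer_ofEquiv, Isom.ofEquiv_onUser,
          reindex_vecMulVec_star, reindex_vecMulVec_star]
        have : ∀ v w : C.Full × (Messages f 2 × Unit) → ℂ, v = w →
          Matrix.vecMulVec v (star v) = Matrix.vecMulVec w (star w) := by rintro v _ rfl; rfl
        refine this _ _ (funext fun x => ?_)
        exact C.stateVector_insert a k ht x

theorem simulation_speciousSecret : C.simulation.SpeciousSecret (classicalInputs 2) := by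
  refine Protocol.speciousSecret_of_hidesChoice _ ?_
  refine C.rounds_hidesChoice _ (List.nodup_finRange s) _ ∅ (by simp) _ fun a k => ?_
  refine Isom.onUser_vecMulVec_star _ _ _ fun x s => ?_
  refine (Fintype.sum_unique (ι := Unit) _).trans ?_
  have h : C.pairs a ∅ x.1 = fun t => (x.1 t, 0) := funext fun t =>
    C.pairs_self_of_notMem a (Set.notMem_empty t) x.1
  simp only [Isom.prepare, Matrix.of_apply, Protocol.initialVector, simulation, stateVector,
    queryState, ite_and, h]
  split_ifs <;> simp

end ClassicalPIR

/-! ### Honest execution of Protocol B. -/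

namespace Entangled

/-- The state of the server with messages `a`, the qubits in `|0⟩|0⟩` and his registers in a
multiple of the completely mixed state. -/
def mixedState {h : ℕ} (a : Str h) (c : ℂ) :
    Matrix (Qubits × (Str h × Regs h)) (Qubits × (Str h × Regs h)) ℂ :=
  (Matrix.diagonal fun b => if b = (0, 0) then 1 else 0) ⊗ₖ
    ((Matrix.diagonal fun a' => if a' = a then 1 else 0) ⊗ₖ Matrix.diagonal fun _ => c)

/-- The state that arises from `mixedState` by the unitary `V`. -/
def encodedState {h : ℕ} (ℓ : Fin h) (a : Str h) (c : ℂ) :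
    Matrix (Qubits × (Str h × Regs h)) (Qubits × (Str h × Regs h)) ℂ :=
  (V ℓ).mat * mixedState a c * (V ℓ).matᴴ

theorem add_self_right (b c : Fin 2) : b + c + c = b := by
  revert b c
  decide

/-- The permutation of the basis that `V` is. -/
def permV {h : ℕ} (ℓ : Fin h) : Equiv.Perm (Qubits × (Str h × Regs h)) :=
  Function.Involutive.toPerm
    (fun x => ((x.1.1 + dot (half 0 (previous x.2.1 x.2.2 ℓ)) (x.2.2 ℓ),
      x.1.2 + dot (half 1 (previous x.2.1 x.2.2 ℓ)) (x.2.2 ℓ)), x.2))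
    (fun _ => Prod.ext (Prod.ext (add_self_right _ _) (add_self_right _ _)) rfl)

theorem V_eq_ofEquiv {h : ℕ} (ℓ : Fin h) : V ℓ = Isom.ofEquiv (permV ℓ) := rfl

theorem permV_symm {h : ℕ} (ℓ : Fin h) : (permV ℓ).symm = permV ℓ :=
  Function.Involutive.toPerm_symm _

/-- `V` is an involution, since bits are added modulo 2: its second use uncomputes the qubits. -/
theorem V_mul_encodedState {h : ℕ} (ℓ : Fin h) (a : Str h) (c : ℂ) :
    (V ℓ).mat * encodedState ℓ a c * (V ℓ).matᴴ = mixedState a c := by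
  rw [encodedState, V_eq_ofEquiv, Isom.ofEquiv_mul_mul, Isom.ofEquiv_mul_mul]
  ext x y
  simp only [Matrix.reindex_apply, Matrix.submatrix_apply]
  nth_rw 2 [permV_symm]
  nth_rw 3 [permV_symm]
  simp

theorem exists_encodedState_eq_diagonal {h : ℕ} (ℓ : Fin h) (a : Str h) (c : ℂ) :
    ∃ d, encodedState ℓ a c = Matrix.diagonal d := by
  rw [encodedState, V_eq_ofEquiv, Isom.ofEquiv_mul_mul, mixedState,
    Matrix.diagonal_kronecker_diagonal, Matrix.diagonal_kronecker_diagonal, Matrix.reindex_apply,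
    Matrix.submatrix_diagonal_equiv]
  exact ⟨_, rfl⟩

/-- `V` only permutes the basis, so the encoded state is diagonal; conjugation by a diagonal matrix
of signs multiplies each diagonal entry by a squared sign. Hence the choice bit leaves no trace in
the server's state. -/
theorem pauliZ_mul_encodedState {h : ℕ} (i : Bool) (ℓ : Fin h) (a : Str h) (c : ℂ) :
    ((pauliZ i).mat ⊗ₖ (1 : Matrix (Str h × Regs h) (Str h × Regs h) ℂ)) * encodedState ℓ a c *
      ((pauliZ i).mat ⊗ₖ (1 : Matrix (Str h × Regs h) (Str h × Regs h) ℂ))ᴴ =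
      encodedState ℓ a c := by
  obtain ⟨d, hd⟩ := exists_encodedState_eq_diagonal ℓ a c
  rw [hd, pauliZ, ← Matrix.diagonal_one, Matrix.diagonal_kronecker_diagonal,
    Matrix.diagonal_conjTranspose, Matrix.diagonal_mul_diagonal, Matrix.diagonal_mul_diagonal]
  congr 1
  funext x
  simp only [Pi.star_apply, mul_one]
  split_ifs <;> simp

theorem hadamard_mul_mixedState {h : ℕ} (ℓ : Fin h) (a : Str h) (c : ℂ) :
    ((Isom.id Qubits).tensor ((Isom.id (Str h)).tensor (hadamardAt ℓ))).mat * mixedState a c *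
      ((Isom.id Qubits).tensor ((Isom.id (Str h)).tensor (hadamardAt ℓ))).matᴴ =
      mixedState a c := by
  have h1 : (hadamardAt ℓ).mat * (Matrix.diagonal fun _ => c) * (hadamardAt ℓ).matᴴ =
      Matrix.diagonal fun _ => c := by
    have h2 : (hadamardAt ℓ).mat * (hadamardAt ℓ).matᴴ = 1 := by
      -- The matrix is square, so the isometry is also unitary and fixes multiples of the identity.
      rw [mul_eq_one_comm]
      exact (hadamardAt ℓ).isometry.trans (by ext; simp [Matrix.one_apply])
    rw [← Matrix.smul_one_eq_diagonal, Matrix.mul_smul, Matrix.mul_one, Matrix.smul_mul, h2]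
  have h3 : ∀ {m : Type} [Fintype m] [DecidableEq m] (M : Matrix m m ℂ),
      (Isom.id m).mat * M * (Isom.id m).matᴴ = M := fun M => by
    simp [Isom.id]
  rw [mixedState, Isom.tensor, Isom.tensor, Matrix.conjTranspose_kronecker,
    Matrix.conjTranspose_kronecker, ← Matrix.mul_kronecker_mul, ← Matrix.mul_kronecker_mul,
    ← Matrix.mul_kronecker_mul, ← Matrix.mul_kronecker_mul, h1, h3, h3]

theorem andThen_mul_mul {m n l : Type} [Fintype m] [Fintype n] [Fintype l] (A : Isom m n)
    (B : Isom n l) (M : Matrix m m ℂ) :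
    (A.andThen B).mat * M * (A.andThen B).matᴴ = B.mat * (A.mat * M * A.matᴴ) * B.matᴴ := by
  simp only [Isom.andThen, Matrix.conjTranspose_mul, Matrix.mul_assoc]

theorem serverState_sendQuery_of_answerState_eq {h : ℕ} {ℓ : Fin h} {a : Str h} {c : ℂ}
    (pre : Isom (Regs h) (Regs h)) (i : Bool)
    {ρ : Matrix ((Regs h × Qubits) × (Str h × Regs h)) ((Regs h × Qubits) × (Str h × Regs h)) ℂ}
    (hρ : answerState ρ = encodedState ℓ a c) :
    serverState (sendQuery (pre.tensor (pauliZ i)) ρ) = encodedState ℓ a c := by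
  rw [serverState_sendQuery_tensor, hρ, pauliZ_mul_encodedState]

/-- The invariant concerns the qubits together with the server's systems, at the time when the user
holds the qubits. `Z` preserves it, `V` and the Hadamard gates bring back `mixedState`, and the next
`V` encodes it again one index lower. The value of the scalar `c` plays no role. -/
theorem rounds_hidesChoice {n : ℕ} (c : ℂ) (l : ℕ) (hl : l < n + 1)
    (pre : Isom (Regs (n + 1)) (Regs (n + 1)))
    (ρ : Str (n + 1) → Fin (2 ^ (n + 1)) →
      Matrix ((Regs (n + 1) × Qubits) × (Str (n + 1) × Regs (n + 1)))
        ((Regs (n + 1) × Qubits) × (Str (n + 1) × Regs (n + 1))) ℂ)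
    (hρ : ∀ a k, answerState (ρ a k) = encodedState ⟨l, hl⟩ a c) :
    (rounds l hl pre).HidesChoice ρ := by
  have key := fun a k i => serverState_sendQuery_of_answerState_eq pre i (hρ a k)
  induction l generalizing pre ρ with
  | zero => exact ⟨fun a k k' => by rw [key, key], trivial⟩
  | succ l ih =>
    refine ⟨fun a k k' => by rw [key, key], ?_⟩
    have h : ∀ a k, answerState (sendAnswer
        ((serverStep ⟨l + 1, hl⟩).andThen (V ⟨l, Nat.lt_of_succ_lt hl⟩)).toChannel
        (sendQuery (pre.tensor (pauliZ (choiceBit k ⟨l + 1, hl⟩))) (ρ a k))) =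
        encodedState ⟨l, Nat.lt_of_succ_lt hl⟩ a c := fun a k => by
      rw [answerState_sendAnswer_toChannel, key, andThen_mul_mul, serverStep, andThen_mul_mul,
        V_mul_encodedState, hadamard_mul_mixedState, encodedState]
    exact ih _ _ _ h fun a k i => serverState_sendQuery_of_answerState_eq _ i (h a k)

theorem sum_epr_mul_star (l : ℕ) (y y' : Str l) :
    ∑ z, epr l y z * star (epr l y' z) = if y = y' then ((2 : ℂ) ^ 2 ^ l)⁻¹ else 0 := by
  have h : (((Real.sqrt (2 ^ 2 ^ l))⁻¹ : ℝ) : ℂ) * (((Real.sqrt (2 ^ 2 ^ l))⁻¹ : ℝ) : ℂ) =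
      ((2 : ℂ) ^ 2 ^ l)⁻¹ := by
    rw [← Complex.ofReal_mul, ← mul_inv, Real.mul_self_sqrt (by positivity)]
    push_cast
    rfl
  rw [Finset.sum_eq_single y]
  · unfold epr
    by_cases hy : y = y'
    · subst hy
      rw [if_pos rfl, if_pos rfl, RCLike.star_def, Complex.conj_ofReal, h]
    · rw [if_neg hy, if_neg (Ne.symm hy), star_zero, mul_zero]
  · intro z _ hz
    rw [epr, if_neg hz.symm, zero_mul]
  · simp

/-- Tracing out the user's halves makes the server's registers completely mixed; this fixes the
scalar `c` used afterwards. -/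
theorem sum_initial_mul_star {h : ℕ} (x y : Qubits × Regs h) :
    ∑ u, initial h (u, x) * star (initial h (u, y)) =
      if (x.1 = (0, 0) ∧ y.1 = (0, 0)) ∧ x.2 = y.2 then
        ∏ ℓ : Fin h, ((2 : ℂ) ^ 2 ^ (ℓ : ℕ))⁻¹ else 0 := by
  have h1 : ∑ u : Regs h, (∏ ℓ : Fin h, epr ℓ (x.2 ℓ) (u ℓ)) *
      star (∏ ℓ : Fin h, epr ℓ (y.2 ℓ) (u ℓ)) =
      if x.2 = y.2 then ∏ ℓ : Fin h, ((2 : ℂ) ^ 2 ^ (ℓ : ℕ))⁻¹ else 0 := by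
    simp only [star_prod, ← Finset.prod_mul_distrib]
    rw [← Fintype.prod_sum fun (ℓ : Fin h) z => epr ℓ (x.2 ℓ) z * star (epr ℓ (y.2 ℓ) z)]
    simp only [sum_epr_mul_star]
    rw [Finset.prod_ite_zero]
    simp [funext_iff]
  have h2 : ∀ u, initial h (u, x) * star (initial h (u, y)) =
      ((if x.1 = (0, 0) then 1 else 0) * if y.1 = (0, 0) then 1 else 0) *
        ((∏ ℓ : Fin h, epr ℓ (x.2 ℓ) (u ℓ)) * star (∏ ℓ : Fin h, epr ℓ (y.2 ℓ) (u ℓ))) := by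
    intro u
    unfold initial
    split_ifs <;> simp
  simp only [h2]
  rw [← Finset.mul_sum, h1]
  split_ifs <;> simp_all

theorem ite_eq_ite_mul_ite {α : Type*} [DecidableEq α] (x y z : α) :
    (if x = y then if x = z then 1 else 0 else 0 : ℂ) =
      (if x = z then 1 else 0) * if y = z then 1 else 0 := by
  by_cases h : x = y
  · subst h
    simp
  · rw [if_neg h, ite_zero_mul_ite_zero, if_neg fun h' => h (h'.1.trans h'.2.symm)]

theorem serverState_sendQuery_initial {h : ℕ} (a : Str h)
    (φ : Regs h × (Str h × (Qubits × Regs h)) → ℂ)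
    (hφ : ∀ u a' x, φ (u, a', x) = initial h (u, x) * if a' = a then 1 else 0)
    (b b' : Qubits) (a₁ a₂ : Str h) (r r' : Regs h) :
    serverState (sendQuery (Isom.ofEquiv (Equiv.prodPUnit (Regs h)).symm)
      (Matrix.vecMulVec φ (star φ))) ((), a₁, b, r) ((), a₂, b', r') =
      mixedState a (∏ ℓ : Fin h, ((2 : ℂ) ^ 2 ^ (ℓ : ℕ))⁻¹) (b, a₁, r) (b', a₂, r') := by
  have h1 : ∀ u, φ (u, a₁, b, r) * star (φ (u, a₂, b', r')) =
      ((if a₁ = a then 1 else 0) * if a₂ = a then 1 else 0) *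
        (initial h (u, (b, r)) * star (initial h (u, (b', r')))) := by
    intro u
    rw [hφ, hφ]
    split_ifs <;> simp
  rw [sendQuery_ofEquiv]
  simp only [serverState, Matrix.of_apply, Matrix.reindex_apply, Matrix.submatrix_apply,
    Matrix.vecMulVec_apply, Pi.star_apply]
  refine (Finset.sum_congr rfl fun u _ => h1 u).trans ?_
  rw [← Finset.mul_sum, sum_initial_mul_star]
  simp only [mixedState, Matrix.kronecker_apply, Matrix.diagonal_apply]
  generalize ∏ ℓ : Fin h, ((2 : ℂ) ^ 2 ^ (ℓ : ℕ))⁻¹ = c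
  rw [ite_eq_ite_mul_ite b b', ite_eq_ite_mul_ite a₁ a₂, ite_and, ite_and]
  by_cases hb : b = (0, 0)
  · by_cases hb' : b' = (0, 0)
    · rw [if_pos hb, if_pos hb', if_pos hb, if_pos hb', one_mul, one_mul]
    · rw [if_pos hb, if_neg hb', if_neg hb', mul_zero, mul_zero, zero_mul]
  · rw [if_neg hb, if_neg hb, mul_zero, zero_mul, zero_mul]

theorem answerState_sendAnswer_firstOp {n : ℕ} (a : Str (n + 1))
    (φ : Regs (n + 1) × (Str (n + 1) × (Qubits × Regs (n + 1))) → ℂ)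
    (hφ : ∀ u a' x, φ (u, a', x) = initial (n + 1) (u, x) * if a' = a then 1 else 0) :
    answerState (sendAnswer (firstOp n).toChannel
      (sendQuery (Isom.ofEquiv (Equiv.prodPUnit (Regs (n + 1))).symm)
        (Matrix.vecMulVec φ (star φ)))) =
      encodedState (Fin.last n) a (∏ ℓ : Fin (n + 1), ((2 : ℂ) ^ 2 ^ (ℓ : ℕ))⁻¹) := by
  refine (answerState_sendAnswer_toChannel (firstOp n) _).trans ?_
  rw [firstOp, andThen_mul_mul, encodedState, Isom.ofEquiv_mul_mul]
  refine congrArg (fun M => (V (Fin.last n)).mat * M * (V (Fin.last n)).matᴴ) ?_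
  ext ⟨b, a₁, r⟩ ⟨b', a₂, r'⟩
  exact serverState_sendQuery_initial a φ hφ b b' a₁ a₂ r r'

theorem protocol_speciousSecret (n : ℕ) :
    (protocol n).SpeciousSecret (classicalInputs 2) := by
  -- The first query is trivial and its state does not involve the choice.
  refine Protocol.speciousSecret_of_hidesChoice _ ⟨fun _ _ _ => rfl, ?_⟩
  exact rounds_hidesChoice (∏ ℓ : Fin (n + 1), ((2 : ℂ) ^ 2 ^ (ℓ : ℕ))⁻¹) _ _ _ _ fun a k =>
    answerState_sendAnswer_firstOp a _ fun _ _ _ => rfl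

end Entangled

end QPIR

end

theorem corollary1 :
    (∀ (f s : ℕ) (C : QPIR.ClassicalPIR f s),
      C.simulation.SpeciousSecret (QPIR.classicalInputs 2)) ∧
    (∀ n : ℕ, (QPIR.Entangled.protocol n).SpeciousSecret (QPIR.classicalInputs 2)) :=
  ⟨fun _ _ C => C.simulation_speciousSecret, QPIR.Entangled.protocol_speciousSecret⟩
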